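/- **Setting.** Let $p(q,s)=\sum_{k=0}^m p_k(q)s^k$ with $m\ge 2$, $p_k\in\mathbb R[q]=\mathbb R[q_1,\dots,q_n]$, $p_m\equiv 1$; let $p'=\partial p/\partial s$ and $\mathcal Q=[-1,1]^n$. For $f\in\{p,p'\}$ let $a_f(q)$ be the maximal real part of the roots of $f(q,\cdot)$, let $f_\Re,f_\Im\in\mathbb R[q,x,y]$ be the real and imaginary parts of $f(q,x+iy)$, and let $\mathcal Z_f=\{(q,x,y)\in\mathcal Q\times\mathbb R^2: f_\Re(q,x,y)=f_\Im(q,x,y)=0\}$; write $\mathcal Z=\mathcal Z_p$. $\mathbb R[\cdot]_k$ denotes polynomials of total degree at most $k$ (only $0$ if $k<0$) and $\Sigma[\cdot]_k$ the sums of squares of polynomials in it. *Upper program for $p'$, order $d'$.* Let $\rho^{\mathrm{up}}_{d'}$ be the infimum of $\int_{\mathcal Q}v\,dq$ over $v\in\mathbb R[q]_{2d'}$ such that $v-x=\sigma_0+\sum_{j=1}^n\sigma_j(1-q_j^2)+\tau_\Re p'_\Re+\tau_\Im p'_\Im$ for some $\sigma_0\in\Sigma[q,x,y]_{2d'}$,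 $\sigma_j\in\Sigma[q,x,y]_{2d'-2}$, $\tau_\Re,\tau_\Im\in\mathbb R[q,x,y]_{2d'-(m-1)}$. A feasible $v$ is *near optimal* if $\int_{\mathcal Q}v\,dq\le\rho^{\mathrm{up}}_{d'}+\frac1{d'}$. *Lower program of order $d$.* Given $\hat v_{d'}$ feasible for the upper program of order $d'$, put $\mathcal Z_{r,d'}=\{(q,x,y)\in\mathcal Z: x\ge\hat v_{d'}(q)\}$ and let $\pi_{\mathcal Q}(\mathcal Z_{r,d'})$ be its projection to $\mathcal Q$. Let $\rho_{d',d}$ be the supremum of $\int_{\pi_{\mathcal Q}(\mathcal Z_{r,d'})}w\,dq$ over $w\in\mathbb R[q]_{2d}$ such that $x-w=\sigma_0+\sum_{j}\sigma_j(1-q_j^2)+\sigma_{\hat v}(x-\hat v_{d'})+\tau_\Re p_\Re+\tau_\Im p_\Im$ for some $\sigma_0\in\Sigma[q,x,y]_{2d}$, $\sigma_j\in\Sigma[q,x,y]_{2d-2}$, $\sigma_{\hat v}\in\Sigma[q,x,y]_{2d-d'}$, $\tau_\Re,\tau_\Im\in\mathbb R[q,x,y]_{2d-m}$. A feasible $w$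 is *near optimal* if $\int_{\pi_{\mathcal Q}(\mathcal Z_{r,d'})}w\,dq\ge\rho_{d',d}-\frac1d$. **Assumptions.** (1) $x\notin\,]a_{p'}(q),a_p(q)[$ for all $(q,x,y)\in\mathcal Z$. (2) For some $d'$ there is a near optimal $\hat v_{d'}$ for the upper program for $p'$ that coincides with $a_{p'}$ on $\mathcal D=\{q\in\mathcal Q:a_p(q)=a_{p'}(q)\}$. **Theorem.** Let (1) and (2) hold and let $\delta>0$. (a) There are a Borel set $\mathcal A_\delta\subseteq\mathcal Q$ of volume less than $\delta$, orders $d'_1<d'_2<\cdots$ and near optimal solutions $\hat v_{d'_l}$ of the upper programs of order $d'_l$ for $p'$ such that $\hat v_{d'_l}\to a_{p'}$ uniformly on $\mathcal A_\delta^C=\mathcal Q\setminus\mathcal A_\delta$ and $\hat v_{d'_l}\le a_p$ on $\mathcal A_\delta^C$ for all $l$. (b) Let $\mathcal A_\delta\subseteq\mathcal Q$ be any Borel set of volume less than $\delta$ and $\hat v_{d'}$ any near optimal solution of the upper program of order $d'$ for $p'$ with $\hat v_{d'}\le a_p$ on $\mathcal A_\delta^C$. Suppose that the following borderline case does not occur: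 $x=a_{p'}(q)=\hat v_{d'}(q)<a_p(q)$ for some $(q,x,y)\in\mathcal Z$. Then for all sufficiently large $d$ the lower program of order $d$ has near optimal solutions; and whenever $w_d$ is near optimal for the lower program of order $d$ for every $d\ge d_0$, then $w_d\le a_p$ on $\mathcal A_\delta^C$ for every $d\ge d_0$, $a_p\in L^1(\mathcal Q)$, and $w_d\to a_p$ in $L^1(\mathcal A_\delta^C)$ as $d\to\infty$. -/

import Mathlib

namespace AbscissaGL

open MeasureTheory

noncomputable section

/-- `ℝ[q]`, the polynomials in the parameters `q = (q_1, …, q_n)`. -/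
abbrev PolyQ (n : ℕ) := MvPolynomial (Fin n) ℝ

/-- `ℝ[q, x, y]`: the variables `Sum.inl j` are the `q_j`, `Sum.inr 0` is `x`, `Sum.inr 1` is `y`. -/
abbrev PolyQXY (n : ℕ) := MvPolynomial (Fin n ⊕ Fin 2) ℝ

/-- The variable `q_j` of `ℝ[q, x, y]`. -/
def varQ {n : ℕ} (j : Fin n) : PolyQXY n := MvPolynomial.X (Sum.inl j)

/-- The variable `x` of `ℝ[q, x, y]`. -/
def varX {n : ℕ} : PolyQXY n := MvPolynomial.X (Sum.inr 0)

/-- The variable `y` of `ℝ[q, x, y]`. -/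
def varY {n : ℕ} : PolyQXY n := MvPolynomial.X (Sum.inr 1)

/-- The inclusion of `ℝ[q]` in `ℝ[q, x, y]`. -/
def liftQ {n : ℕ} (v : PolyQ n) : PolyQXY n := MvPolynomial.rename Sum.inl v

/-- The value of a polynomial in `ℝ[q, x, y]` at the point `(q, x, y)`. -/
def evalQXY {n : ℕ} (q : Fin n → ℝ) (x y : ℝ) (g : PolyQXY n) : ℝ :=
  MvPolynomial.eval (Sum.elim q ![x, y]) g

/-- The parameter set `[-1, 1]^n`. -/
def box (n : ℕ) : Set (Fin n → ℝ) := {q | ∀ j, q j ∈ Set.Icc (-1 : ℝ) 1}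

/-- The complex number `f(q, s) = ∑ k, f_k(q) s^k`, where `f_k ∈ ℝ[q]`. -/
def evalC {n : ℕ} (f : Polynomial (PolyQ n)) (q : Fin n → ℝ) (s : ℂ) : ℂ :=
  f.eval₂ ((algebraMap ℝ ℂ).comp (MvPolynomial.eval q)) s

/-- The abscissa of `f`: the maximal real part of the roots of `f(q, ·)`.
(See `isGreatest_abscissa`: the supremum is a maximum.) -/
def abscissa {n : ℕ} (f : Polynomial (PolyQ n)) (q : Fin n → ℝ) : ℝ :=
  sSup {x : ℝ | ∃ s : ℂ, evalC f q s = 0 ∧ s.re = x}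

/-- The real and the imaginary part of `(x + i y)^k`, as elements of `ℝ[q, x, y]`. -/
def powParts {n : ℕ} : ℕ → PolyQXY n × PolyQXY n
  | 0 => (1, 0)
  | k + 1 => (varX * (powParts k).1 - varY * (powParts k).2,
      varX * (powParts k).2 + varY * (powParts k).1)

/-- The polynomial `f_ℜ ∈ ℝ[q, x, y]` with `f_ℜ(q, x, y) = Re f(q, x + i y)`. -/
def rePart {n : ℕ} (f : Polynomial (PolyQ n)) : PolyQXY n :=
  f.sum fun k c => liftQ c * (powParts k).1

/-- The polynomial `f_ℑ ∈ ℝ[q, x, y]` with `f_ℑ(q, x, y) = Im f(q, x + i y)`. -/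
def imPart {n : ℕ} (f : Polynomial (PolyQ n)) : PolyQXY n :=
  f.sum fun k c => liftQ c * (powParts k).2

/-- The set `Z` of all `(q, x, y)` with `q ∈ [-1, 1]^n` and
`f_ℜ(q, x, y) = f_ℑ(q, x, y) = 0`. -/
def rootSet {n : ℕ} (f : Polynomial (PolyQ n)) : Set ((Fin n → ℝ) × ℝ × ℝ) :=
  {z | z.1 ∈ box n ∧ evalQXY z.1 z.2.1 z.2.2 (rePart f) = 0 ∧
    evalQXY z.1 z.2.1 z.2.2 (imPart f) = 0}

/-- The set `Z_r` of all `(q, x, y) ∈ Z` with `x - v(q) ≥ 0`. -/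
def restrictedRootSet {n : ℕ} (f : Polynomial (PolyQ n)) (v : PolyQ n) :
    Set ((Fin n → ℝ) × ℝ × ℝ) :=
  {z | z ∈ rootSet f ∧ 0 ≤ z.2.1 - MvPolynomial.eval z.1 v}

/-- The projection of `Z_r` to the parameter set. -/
def projRestricted {n : ℕ} (f : Polynomial (PolyQ n)) (v : PolyQ n) : Set (Fin n → ℝ) :=
  {q | ∃ x y : ℝ, (q, x, y) ∈ restrictedRootSet f v}

/-- `g` is a polynomial of total degree at most `k`; for `k < 0` this means `g = 0`. -/
def DegLE {σ : Type} (g : MvPolynomial σ ℝ) (k : ℤ) : Prop :=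
  g = 0 ∨ (g.totalDegree : ℤ) ≤ k

/-- `g` is a sum of squares of polynomials, of total degree at most `k`. -/
def SosLE {σ : Type} (g : MvPolynomial σ ℝ) (k : ℤ) : Prop :=
  IsSumSq g ∧ DegLE g k

/-- `v` is feasible for the upper semidefinite program of order `d` for `f`. -/
def UpperFeasible {n : ℕ} (f : Polynomial (PolyQ n)) (d : ℕ) (v : PolyQ n) : Prop :=
  DegLE v (2 * d) ∧
  ∃ (σ₀ : PolyQXY n) (σ : Fin n → PolyQXY n) (τR τI : PolyQXY n),
    SosLE σ₀ (2 * d) ∧ (∀ j, SosLE (σ j) (2 * d - 2)) ∧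
    DegLE τR (2 * d - f.natDegree) ∧ DegLE τI (2 * d - f.natDegree) ∧
    liftQ v - varX =
      σ₀ + ∑ j, σ j * (1 - varQ j ^ 2) + τR * rePart f + τI * imPart f

/-- The value of the upper semidefinite program of order `d` for `f`: the infimum of
`∫ v(q) dq` over `[-1, 1]^n`. Feasible values are bounded below by the integral of the abscissa. -/
def upperValue {n : ℕ} (f : Polynomial (PolyQ n)) (d : ℕ) : ℝ :=
  sInf {r : ℝ | ∃ v : PolyQ n, UpperFeasible f d v ∧ r = ∫ q in box n, MvPolynomial.eval q v}

/-- `v` is a near optimal solution of the upper semidefinite program of order `d` for `f`. -/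
def UpperNearOptimal {n : ℕ} (f : Polynomial (PolyQ n)) (d : ℕ) (v : PolyQ n) : Prop :=
  UpperFeasible f d v ∧
    ∫ q in box n, MvPolynomial.eval q v ≤ upperValue f d + 1 / (d : ℝ)

/-- `w` is feasible for the lower semidefinite program of order `d` for `p`, where the set of
roots is restricted by the polynomial `v` of order `d'`. -/
def LowerFeasible {n : ℕ} (p : Polynomial (PolyQ n)) (d' : ℕ) (v : PolyQ n) (d : ℕ)
    (w : PolyQ n) : Prop :=
  DegLE w (2 * d) ∧
  ∃ (σ₀ : PolyQXY n) (σ : Fin n → PolyQXY n) (σv τR τI : PolyQXY n),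
    SosLE σ₀ (2 * d) ∧ (∀ j, SosLE (σ j) (2 * d - 2)) ∧ SosLE σv (2 * d - d') ∧
    DegLE τR (2 * d - p.natDegree) ∧ DegLE τI (2 * d - p.natDegree) ∧
    varX - liftQ w =
      σ₀ + ∑ j, σ j * (1 - varQ j ^ 2) + σv * (varX - liftQ v)
        + τR * rePart p + τI * imPart p

/-- The value of the lower semidefinite program of order `d`: the supremum of `∫ w(q) dq` over the
projection of `Z_r`. Feasible values are bounded above by the integral of the abscissa. -/
def lowerValue {n : ℕ} (p : Polynomial (PolyQ n)) (d' : ℕ) (v : PolyQ n) (d : ℕ) : ℝ :=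
  sSup {r : ℝ | ∃ w : PolyQ n, LowerFeasible p d' v d w ∧
    r = ∫ q in projRestricted p v, MvPolynomial.eval q w}

/-- `w` is a near optimal solution of the lower semidefinite program of order `d`. -/
def LowerNearOptimal {n : ℕ} (p : Polynomial (PolyQ n)) (d' : ℕ) (v : PolyQ n) (d : ℕ)
    (w : PolyQ n) : Prop :=
  LowerFeasible p d' v d w ∧
    lowerValue p d' v d - 1 / (d : ℝ) ≤ ∫ q in projRestricted p v, MvPolynomial.eval q w

/-- No root of `p(q, ·)` has a real part strictly between `a_{p'}(q)` and `a_p(q)`. -/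
def NoRootBetween {n : ℕ} (p : Polynomial (PolyQ n)) : Prop :=
  ∀ z ∈ rootSet p, z.2.1 ∉ Set.Ioo (abscissa p.derivative z.1) (abscissa p z.1)

/-- The set `D` of the parameters `q ∈ [-1, 1]^n` with `a_p(q) = a_{p'}(q)`. -/
def coincidenceSet {n : ℕ} (p : Polynomial (PolyQ n)) : Set (Fin n → ℝ) :=
  {q | q ∈ box n ∧ abscissa p q = abscissa p.derivative q}

/-- Some near optimal solution of some upper semidefinite program for `p'` coincides with `a_{p'}`
on `D`. -/
def ExactOnCoincidence {n : ℕ} (p : Polynomial (PolyQ n)) : Prop :=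
  ∃ (d' : ℕ) (v : PolyQ n), UpperNearOptimal p.derivative d' v ∧
    ∀ q ∈ coincidenceSet p, MvPolynomial.eval q v = abscissa p.derivative q

/-- `v` does not touch `a_{p'}` at a parameter `q` for which `p(q, ·)` has a root of real part
`a_{p'}(q) < a_p(q)`. -/
def NoBorderlineRoot {n : ℕ} (p : Polynomial (PolyQ n)) (v : PolyQ n) : Prop :=
  ∀ z ∈ rootSet p, z.2.1 = abscissa p.derivative z.1 → z.2.1 < abscissa p z.1 →
    MvPolynomial.eval z.1 v ≠ abscissa p.derivative z.1

/-- `A` is a Borel subset of `[-1, 1]^n` of volume less than `δ`. -/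
def IsSmallSet {n : ℕ} (δ : ℝ) (A : Set (Fin n → ℝ)) : Prop :=
  MeasurableSet A ∧ A ⊆ box n ∧ volume A < ENNReal.ofReal δ

/-- Sanity check: `f_ℜ` and `f_ℑ` are the real and the imaginary part of `f(q, x + i y)`. -/
theorem evalC_eq {n : ℕ} (f : Polynomial (PolyQ n)) (q : Fin n → ℝ) (x y : ℝ) :
    evalC f q ⟨x, y⟩ = ⟨evalQXY q x y (rePart f), evalQXY q x y (imPart f)⟩ := by
  have hpow : ∀ k : ℕ, (⟨x, y⟩ : ℂ) ^ k =
      ⟨evalQXY q x y (powParts k).1, evalQXY q x y (powParts k).2⟩ := by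
    intro k
    induction k with
    | zero => apply Complex.ext <;> simp [powParts, evalQXY]
    | succ k ih =>
      rw [pow_succ', ih]
      apply Complex.ext <;> simp [powParts, evalQXY, varX, varY]
  have hlift : ∀ c : PolyQ n, evalQXY q x y (liftQ c) = MvPolynomial.eval q c := by
    intro c
    simp only [evalQXY, liftQ, MvPolynomial.eval_rename]
    rfl
  have hmul : ∀ g h : PolyQXY n,
      evalQXY q x y (g * h) = evalQXY q x y g * evalQXY q x y h := by
    intro g h; simp [evalQXY]
  have hsum : ∀ (s : Finset ℕ) (g : ℕ → PolyQXY n),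
      evalQXY q x y (∑ k ∈ s, g k) = ∑ k ∈ s, evalQXY q x y (g k) := by
    intro s g; simp [evalQXY]
  apply Complex.ext
  · simp [evalC, rePart, Polynomial.eval₂_eq_sum, Polynomial.sum_def, hsum, hmul, hlift, hpow]
  · simp [evalC, imPart, Polynomial.eval₂_eq_sum, Polynomial.sum_def, hsum, hmul, hlift, hpow]

/-- Sanity check: the abscissa is attained as soon as `f(q, ·)` is not constant. -/
theorem isGreatest_abscissa {n : ℕ} (f : Polynomial (PolyQ n)) (q : Fin n → ℝ)
    (hf : (f.map ((algebraMap ℝ ℂ).comp (MvPolynomial.eval q))).degree ≠ 0)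
    (h0 : f.map ((algebraMap ℝ ℂ).comp (MvPolynomial.eval q)) ≠ 0) :
    IsGreatest {x : ℝ | ∃ s : ℂ, evalC f q s = 0 ∧ s.re = x} (abscissa f q) := by
  set g := f.map ((algebraMap ℝ ℂ).comp (MvPolynomial.eval q)) with hg
  have hev : ∀ s, evalC f q s = g.eval s := by
    intro s; rw [hg, Polynomial.eval_map]; rfl
  have hset : {x : ℝ | ∃ s : ℂ, evalC f q s = 0 ∧ s.re = x} =
      Complex.re '' {s | g.IsRoot s} := by
    ext x; simp [hev, Polynomial.IsRoot]
  obtain ⟨s, hs⟩ := IsAlgClosed.exists_root g hf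
  unfold abscissa
  rw [hset]
  have hfin : (Complex.re '' {s | g.IsRoot s}).Finite :=
    (Polynomial.finite_setOfPred_isRoot h0).image _
  have hne : (Complex.re '' {s | g.IsRoot s}).Nonempty := ⟨s.re, s, hs, rfl⟩
  exact ⟨hne.csSup_mem hfin, fun x hx => le_csSup hfin.bddAbove hx⟩

end

end AbscissaGL

open AbscissaGL MeasureTheory Filter Topology

open AbscissaGL MeasureTheory Filter Topology

namespace AbscissaGL

/-! Both programs are degree truncations of membership in the quadratic module generated by the `1 -
q_j ^ 2`, the two root equations and, for the lower program, `x - v`. The leading coefficient in `s`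
is a nonzero constant, so roots over the box are bounded, and this bound is itself certified: the
module is archimedean. Putinar's Positivstellensatz (`mem_certModule_of_pos`) then certifies every
polynomial that is positive on the restricted root set. The abscissa is continuous, so polynomial
approximation yields feasible polynomials uniformly close to it, and near optimal solutions, being
one-sided bounds, converge to it in mean.

Part (a) depends on the volume of `D`. If `D` is null, a subsequence of near optimal solutions
converges a.e., and Egorov's theorem makes the convergence uniform off a small set. The set where
`a_p - a_{p'} < 1/(j+1)` is also small for large `j`; off both sets, a tail of the sequence lies
below `a_p`. If `D` has positive volume, let `v` be the polynomial of assumption (2). On `D`, some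
root of `p'` lies on the line `Re = v(q)`, and it and its conjugate are symmetric about `v(q)`.
Hence the resultant in `t` of `p'(q, v + t)` and `p'(q, v - t)` vanishes on `D`, so identically.
Every `q` thus has a pair of roots `v(q) ± t`, which gives `v ≤ a_{p'}`
(`HasConstantLead.eval_le_abscissa`). Feasibility gives the reverse inequality on the box, and `v =
a_{p'} ≤ a_p` by Gauss-Lucas, so the constant sequence `v` serves.

For part (b), `x ≥ v ≥ a_{p'}` on the restricted root set; assumption (1) and the excluded
borderline case leave only `x = a_p` (`eq_abscissa_of_mem_restrictedRootSet`). Polynomials slightly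
below `a_p` are therefore feasible, and convergence in mean holds on the projection, which contains
the complement of `A`. -/

/-- `M` is a quadratic module of the commutative ring `A`. -/
structure IsQuadraticModule {A : Type*} [CommRing A] (M : Set A) : Prop where
  one_mem : 1 ∈ M
  add_mem : ∀ {a b : A}, a ∈ M → b ∈ M → a + b ∈ M
  sq_mul_mem : ∀ (a : A) {b : A}, b ∈ M → a ^ 2 * b ∈ M

/-- Every element of `A` is bounded above by a real number modulo `M`. -/
def IsArchimedeanModule {A : Type*} [CommRing A] [Algebra ℝ A] (M : Set A) : Prop :=
  ∀ a : A, ∃ N : ℝ, algebraMap ℝ A N - a ∈ M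

namespace IsQuadraticModule

/-! ### Quadratic modules and maximal proper ones. -/

section Ring

variable {A : Type*} [CommRing A] {M : Set A}

theorem zero_mem (hM : IsQuadraticModule M) : 0 ∈ M := by
  simpa using hM.sq_mul_mem 0 hM.one_mem

theorem sumSq_mul_mem (hM : IsQuadraticModule M) {s b : A} (hs : IsSumSq s) (hb : b ∈ M) :
    s * b ∈ M := by
  induction hs with
  | zero => simpa using hM.zero_mem
  | sq_add a _ ih =>
    rw [add_mul, ← pow_two]
    exact hM.add_mem (hM.sq_mul_mem a hb) ih

theorem sumSq_mem (hM : IsQuadraticModule M) {s : A} (hs : IsSumSq s) : s ∈ M := by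
  simpa using hM.sumSq_mul_mem hs hM.one_mem

theorem isSumSq_pow {u : A} (hu : IsSumSq u) (k : ℕ) : IsSumSq (u ^ k) := by
  induction k with
  | zero => simp
  | succ k ih => rw [pow_succ]; exact ih.mul hu

theorem pow_two_mem (hM : IsQuadraticModule M) (a : A) : a ^ 2 ∈ M := by
  simpa using hM.sq_mul_mem a hM.one_mem

theorem sum_mem (hM : IsQuadraticModule M) {ι : Type*} (s : Finset ι) (g : ι → A)
    (h : ∀ i ∈ s, g i ∈ M) : ∑ i ∈ s, g i ∈ M := by
  classical
  induction s using Finset.induction_on with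
  | empty => simpa using hM.zero_mem
  | insert i s hi ih =>
    rw [Finset.sum_insert hi]
    exact hM.add_mem (h i (Finset.mem_insert_self i s))
      (ih fun j hj => h j (Finset.mem_insert_of_mem hj))

theorem adjoin (hM : IsQuadraticModule M) (b : A) :
    IsQuadraticModule {c | ∃ q ∈ M, ∃ s, IsSumSq s ∧ c = q + s * b} where
  one_mem := ⟨1, hM.one_mem, 0, IsSumSq.zero, by ring⟩
  add_mem := by
    rintro _ _ ⟨q, hq, s, hs, rfl⟩ ⟨q', hq', s', hs', rfl⟩
    exact ⟨q + q', hM.add_mem hq hq', s + s', hs.add hs', by ring⟩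
  sq_mul_mem := by
    rintro a _ ⟨q, hq, s, hs, rfl⟩
    refine ⟨a ^ 2 * q, hM.sq_mul_mem a hq, a ^ 2 * s, ?_, by ring⟩
    exact IsSumSq.mul (by rw [pow_two]; exact IsSumSq.mul_self a) hs

theorem sUnion {c : Set (Set A)} (hc : IsChain (· ⊆ ·) c) (hne : c.Nonempty)
    (h : ∀ M ∈ c, IsQuadraticModule M) : IsQuadraticModule (⋃₀ c) where
  one_mem := let ⟨M, hM⟩ := hne; ⟨M, hM, (h M hM).one_mem⟩
  add_mem := by
    rintro a b ⟨M, hM, ha⟩ ⟨N, hN, hb⟩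
    rcases hc.total hM hN with hMN | hNM
    · exact ⟨N, hN, (h N hN).add_mem (hMN ha) hb⟩
    · exact ⟨M, hM, (h M hM).add_mem ha (hNM hb)⟩
  sq_mul_mem := by
    rintro a b ⟨M, hM, hb⟩
    exact ⟨M, hM, (h M hM).sq_mul_mem a hb⟩

theorem exists_maximal (hM : IsQuadraticModule M) (hp : -1 ∉ M) :
    ∃ Q, M ⊆ Q ∧ Maximal (fun Q : Set A => IsQuadraticModule Q ∧ -1 ∉ Q) Q := by
  refine zorn_subset_nonempty {Q : Set A | IsQuadraticModule Q ∧ -1 ∉ Q} ?_ M ⟨hM, hp⟩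
  intro c hcs hc hne
  refine ⟨⋃₀ c, ⟨sUnion hc hne fun M hM => (hcs hM).1, ?_⟩,
    fun _ hs => Set.subset_sUnion_of_mem hs⟩
  rintro ⟨M, hM, h⟩
  exact (hcs hM).2 h

end Ring

/-! ### Characters and Putinar's Positivstellensatz. -/

section Algebra

variable {A : Type*} [CommRing A] [Algebra ℝ A] {M : Set A}

theorem isSumSq_algebraMap {r : ℝ} (hr : 0 ≤ r) : IsSumSq (algebraMap ℝ A r) := by
  rw [← Real.mul_self_sqrt hr, map_mul]
  exact IsSumSq.mul_self _

theorem smul_mem (hM : IsQuadraticModule M) {r : ℝ} (hr : 0 ≤ r) {b : A} (hb : b ∈ M) :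
    algebraMap ℝ A r * b ∈ M :=
  hM.sumSq_mul_mem (isSumSq_algebraMap hr) hb

theorem algebraMap_mem (hM : IsQuadraticModule M) {r : ℝ} (hr : 0 ≤ r) :
    algebraMap ℝ A r ∈ M :=
  hM.sumSq_mem (isSumSq_algebraMap hr)

/-- The support of a quadratic module is an ideal. -/
theorem mul_mem_of_mem_support (hM : IsQuadraticModule M) {t : A} (ht : t ∈ M) (ht' : -t ∈ M)
    (a : A) : a * t ∈ M := by
  have h4 : algebraMap ℝ A (1 / 4) * 4 = 1 := by
    rw [← map_ofNat (algebraMap ℝ A) 4, ← map_mul]; norm_num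
  have e : a * t = algebraMap ℝ A (1 / 4) * ((a + 1) ^ 2 * t + (a - 1) ^ 2 * -t) := by
    linear_combination -(a * t) * h4
  rw [e]
  exact hM.smul_mem (by norm_num) (hM.add_mem (hM.sq_mul_mem _ ht) (hM.sq_mul_mem _ ht'))

/-- By maximality, adjoining an element outside `M` produces `-1`; two such representations, for `b`
and for `-b`, are incompatible. -/
theorem mem_or_neg_mem_of_maximal
    (hQ : Maximal (fun Q : Set A => IsQuadraticModule Q ∧ -1 ∉ Q) M) (b : A) :
    b ∈ M ∨ -b ∈ M := by
  obtain ⟨hM, hp⟩ := hQ.prop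
  have key : ∀ c : A, c ∉ M → ∃ q ∈ M, ∃ s, IsSumSq s ∧ -1 = q + s * c := by
    intro c hc
    by_contra hcon
    have hle := hQ.le_of_ge (y := {d | ∃ q ∈ M, ∃ s, IsSumSq s ∧ d = q + s * c})
      ⟨hM.adjoin c, hcon⟩ (fun q hq => ⟨q, hq, 0, IsSumSq.zero, by ring⟩)
    exact hc (hle ⟨0, hM.zero_mem, 1, IsSumSq.one, by ring⟩)
  by_contra! h
  obtain ⟨q, hq, t, ht, e⟩ := key b h.1
  obtain ⟨q', hq', t', ht', e'⟩ := key (-b) h.2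
  -- Eliminating `b` from the two identities puts `t` into the support; as the support is an ideal,
  -- `t * b ∈ M`, and the first identity gives `-1 ∈ M`.
  have hneg : -t ∈ M := by
    have : -t = t' + t' * q + t * q' := by linear_combination t' * e + t * e'
    rw [this]
    exact hM.add_mem (hM.add_mem (hM.sumSq_mem ht') (hM.sumSq_mul_mem ht' hq))
      (hM.sumSq_mul_mem ht hq')
  apply hp
  rw [e, mul_comm]
  exact hM.add_mem hq (hM.mul_mem_of_mem_support (hM.sumSq_mem ht) hneg b)

/-- A total archimedean proper quadratic module is contained in the preimage of the nonnegative
reals under a character. -/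
theorem exists_algHom_of_total (hM : IsQuadraticModule M) (hp : -1 ∉ M)
    (ht : ∀ b, b ∈ M ∨ -b ∈ M) (ha : IsArchimedeanModule M) :
    ∃ φ : A →ₐ[ℝ] ℝ, ∀ g ∈ M, 0 ≤ φ g := by
  let ι := algebraMap ℝ A
  have hneg : ∀ r : ℝ, ι r ∈ M → 0 ≤ r := by
    intro r hr
    by_contra! h
    apply hp
    have : (-1 : A) = ι (-r⁻¹) * ι r := by
      rw [← map_mul, neg_mul, inv_mul_cancel₀ h.ne, map_neg, map_one]
    rw [this]
    exact hM.smul_mem (by have := inv_neg''.mpr h; linarith) hr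
  -- Each `b` is read as a Dedekind cut: the archimedean property makes `S b` nonempty and bounded,
  -- and totality puts `r - b` in `M` for every `r` above its supremum.
  let S : A → Set ℝ := fun b => {r | b - ι r ∈ M}
  let φ : A → ℝ := fun b => sSup (S b)
  have hle : ∀ b r r', b - ι r ∈ M → ι r' - b ∈ M → r ≤ r' := by
    intro b r r' h h'
    have := hM.add_mem h h'
    have e : b - ι r + (ι r' - b) = ι (r' - r) := by rw [map_sub]; ring
    rw [e] at this
    linarith [hneg _ this]
  have hbdd : ∀ b, BddAbove (S b) := by
    intro b
    obtain ⟨N, hN⟩ := ha b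
    exact ⟨N, fun r hr => hle b r N hr hN⟩
  have hne : ∀ b, (S b).Nonempty := by
    intro b
    obtain ⟨N, hN⟩ := ha (-b)
    refine ⟨-N, ?_⟩
    change b - ι (-N) ∈ M
    rw [map_neg]
    convert hN using 1
    ring
  have hlt : ∀ b r, r < φ b → b - ι r ∈ M := by
    intro b r hr
    obtain ⟨r', hr', h⟩ := exists_lt_of_lt_csSup (hne b) hr
    have e : b - ι r = (b - ι r') + ι (r' - r) := by rw [map_sub]; ring
    rw [e]
    exact hM.add_mem hr' (hM.algebraMap_mem (by linarith))
  have hgt : ∀ b r, φ b < r → ι r - b ∈ M := by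
    intro b r hr
    rcases ht (b - ι r) with h | h
    · exact absurd (le_csSup (hbdd b) h) (not_le.mpr hr)
    · simpa using h
  have heq : ∀ b c, (∀ ε > 0, b - ι (c - ε) ∈ M) → (∀ ε > 0, ι (c + ε) - b ∈ M) → φ b = c := by
    intro b c h h'
    apply le_antisymm
    · apply le_of_forall_pos_le_add
      intro ε hε
      exact csSup_le (hne b) fun r hr => hle b r _ hr (h' ε hε)
    · apply le_of_forall_pos_le_add
      intro ε hε
      linarith [le_csSup (hbdd b) (h ε hε)]
  have hconst : ∀ r, φ (ι r) = r := by
    intro r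
    apply heq
    · intro ε hε
      rw [← map_sub]
      exact hM.algebraMap_mem (by linarith)
    · intro ε hε
      rw [← map_sub]
      exact hM.algebraMap_mem (by linarith)
  have hadd : ∀ a b, φ (a + b) = φ a + φ b := by
    intro a b
    apply heq
    · intro ε hε
      have h := hM.add_mem (hlt a (φ a - ε / 2) (by linarith)) (hlt b (φ b - ε / 2) (by linarith))
      convert h using 1
      rw [show φ a + φ b - ε = (φ a - ε / 2) + (φ b - ε / 2) by ring, map_add]
      ring
    · intro ε hε
      have h := hM.add_mem (hgt a (φ a + ε / 2) (by linarith)) (hgt b (φ b + ε / 2) (by linarith))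
      convert h using 1
      rw [show φ a + φ b + ε = (φ a + ε / 2) + (φ b + ε / 2) by ring, map_add]
      ring
  have hsq0 : ∀ a, φ a = 0 → φ (a ^ 2) = 0 := by
    intro a h0
    apply heq
    · intro ε hε
      rw [zero_sub, map_neg, sub_neg_eq_add]
      exact hM.add_mem (by simpa using hM.sq_mul_mem a hM.one_mem) (hM.algebraMap_mem hε.le)
    · intro ε' hε'
      obtain ⟨ε, hε, rfl⟩ : ∃ ε : ℝ, 0 < ε ∧ ε' = ε ^ 2 :=
        ⟨√ε', Real.sqrt_pos.mpr hε', (Real.sq_sqrt hε'.le).symm⟩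
      have h1 : ι ε - a ∈ M := hgt a ε (by linarith)
      have h2 : ι ε + a ∈ M := by
        have := hlt a (-ε) (by linarith)
        rw [map_neg] at this
        convert this using 1
        ring
      -- `(ε + a)² (ε - a) + (ε - a)² (ε + a) = 2ε (ε² - a²)`: linear bounds on `a` become a bound
      -- on its square. No products of elements of `M` are available.
      have h := hM.smul_mem (r := 1 / (2 * ε)) (by positivity)
        (hM.add_mem (hM.sq_mul_mem (ι ε + a) h1) (hM.sq_mul_mem (ι ε - a) h2))
      convert h using 1
      have e : ι (1 / (2 * ε)) * (2 * ι ε) = 1 := by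
        rw [← map_ofNat ι 2, ← map_mul, ← map_mul, one_div_mul_cancel (by positivity), map_one]
      rw [zero_add, map_pow]
      linear_combination (a ^ 2 - ι ε ^ 2) * e
  have hsmul : ∀ r a, φ (ι r * a) = r * φ a := by
    have hnn : ∀ r a, 0 ≤ r → φ (ι r * a) = r * φ a := by
      intro r a hr
      rcases hr.eq_or_lt with rfl | hr
      · simpa using hconst 0
      apply heq
      · intro ε hε
        have h := hM.smul_mem hr.le (hlt a (φ a - ε / r) (by have := div_pos hε hr; linarith))
        convert h using 1
        rw [mul_sub]
        congr 1
        rw [← map_mul]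
        congr 1
        field_simp
      · intro ε hε
        have h := hM.smul_mem hr.le (hgt a (φ a + ε / r) (by have := div_pos hε hr; linarith))
        convert h using 1
        rw [mul_sub]
        congr 1
        rw [← map_mul]
        congr 1
        field_simp
    intro r a
    rcases le_total 0 r with hr | hr
    · exact hnn r a hr
    · have h := hadd (ι r * a) (ι (-r) * a)
      rw [hnn (-r) a (by linarith), map_neg, neg_mul, add_neg_cancel] at h
      have h0 := hconst 0
      rw [map_zero] at h0
      rw [h0] at h
      linarith
  have hsq : ∀ a, φ (a ^ 2) = φ a ^ 2 := by
    intro a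
    have hb : φ (a + ι (-φ a)) = 0 := by rw [hadd, hconst]; ring
    have h := hsq0 _ hb
    have e : (a + ι (-φ a)) ^ 2 = a ^ 2 + (ι (-(2 * φ a)) * a + ι (φ a ^ 2)) := by
      simp only [map_neg, map_mul, map_pow, map_ofNat]
      ring
    rw [e, hadd, hadd, hsmul, hconst] at h
    linarith
  have hmul : ∀ a b, φ (a * b) = φ a * φ b := by
    intro a b
    have h := hsq (a + b)
    have e : (a + b) ^ 2 = a ^ 2 + (ι 2 * (a * b) + b ^ 2) := by
      simp only [map_ofNat]
      ring
    rw [e, hadd, hadd, hsmul, hsq, hsq, hadd] at h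
    linarith
  refine ⟨{ toFun := φ, map_one' := ?_, map_mul' := hmul, map_zero' := ?_, map_add' := hadd,
            commutes' := hconst }, ?_⟩
  · simpa using hconst 1
  · simpa using hconst 0
  · intro g hg
    refine le_csSup (hbdd g) ?_
    change g - ι 0 ∈ M
    simpa using hg

/-- **Putinar's Positivstellensatz**, in the form of the representation theorem for archimedean
quadratic modules. -/
theorem mem_of_forall_algHom_pos (hM : IsQuadraticModule M) (harch : IsArchimedeanModule M)
    (a : A) (hpos : ∀ φ : A →ₐ[ℝ] ℝ, (∀ g ∈ M, 0 ≤ φ g) → 0 < φ a) : a ∈ M := by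
  let ι := algebraMap ℝ A
  -- Otherwise `M` with `-a` adjoined is proper, lies in a maximal module, and yields a character
  -- that is nonnegative on `M` but not positive at `a`.
  obtain ⟨s, hs, m, hm, e⟩ : ∃ s, IsSumSq s ∧ ∃ m ∈ M, s * a = 1 + m := by
    by_contra hcon
    have hp : -1 ∉ {c | ∃ q ∈ M, ∃ s, IsSumSq s ∧ c = q + s * -a} := by
      rintro ⟨q, hq, s, hs, e⟩
      exact hcon ⟨s, hs, q, hq, by linear_combination e⟩
    obtain ⟨Q, hMQ, hQ⟩ := (hM.adjoin (-a)).exists_maximal hp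
    have hMQ' : M ⊆ Q := fun q hq => hMQ ⟨q, hq, 0, IsSumSq.zero, by ring⟩
    obtain ⟨φ, hφ⟩ := hQ.prop.1.exists_algHom_of_total hQ.prop.2 (mem_or_neg_mem_of_maximal hQ)
      fun b => (harch b).imp fun N hN => hMQ' hN
    have h1 := hpos φ fun g hg => hφ g (hMQ' hg)
    have h2 := hφ (-a) (hMQ ⟨0, hM.zero_mem, 1, IsSumSq.one, by ring⟩)
    rw [map_neg] at h2
    linarith
  have hmono : ∀ {r r' : ℝ} {b : A}, r ≤ r' → ι r - b ∈ M → ι r' - b ∈ M := by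
    intro r r' b hr h
    have e : ι r' - b = (ι r - b) + ι (r' - r) := by rw [map_sub]; ring
    rw [e]
    exact hM.add_mem h (hM.algebraMap_mem (by linarith))
  obtain ⟨k, hk, hk1, hk2⟩ : ∃ k : ℝ, 0 < k ∧ ι (2 * k) - s ∈ M ∧
      ι (2 * k) - (s ^ 2 * a + 1) ∈ M := by
    obtain ⟨N₁, h₁⟩ := harch s
    obtain ⟨N₂, h₂⟩ := harch (s ^ 2 * a + 1)
    refine ⟨max 1 (max N₁ N₂), by positivity, hmono ?_ h₁, hmono ?_ h₂⟩
    · have : N₁ ≤ max 1 (max N₁ N₂) := by simp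
      have : (1 : ℝ) ≤ max 1 (max N₁ N₂) := by simp
      linarith
    · have : N₂ ≤ max 1 (max N₁ N₂) := by simp
      have : (1 : ℝ) ≤ max 1 (max N₁ N₂) := by simp
      linarith
  -- The four summands add up to `k² (a + r) - 1`: in `(k - s)² (a + r)` the mixed term `-2ksa`
  -- cancels against `2km = 2k(sa - 1)`, and the terms in `s²` against the two bounds by `2k`. The
  -- gain `1/k²` does not depend on `r`, so finitely many steps bring `r` to `0`.
  have step : ∀ r : ℝ, 0 ≤ r → a + ι r ∈ M → a + ι (r - 1 / k ^ 2) ∈ M := by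
    intro r hr h
    have hss : s * (ι (2 * k) - s) ∈ M := hM.sumSq_mul_mem hs hk1
    have h2 : ι (2 * k) * m ∈ M := hM.smul_mem (by positivity) hm
    have hsum := hM.smul_mem (r := 1 / k ^ 2) (by positivity)
      (hM.add_mem (hM.add_mem (hM.add_mem (hM.sq_mul_mem (ι k - s) h) h2) hk2)
        (hM.smul_mem hr hss))
    convert hsum using 1
    have e1 : ι (1 / k ^ 2) * ι k ^ 2 = 1 := by
      rw [← map_pow, ← map_mul, one_div_mul_cancel (by positivity), map_one]
    have e2 : ι (2 * k) = 2 * ι k := by rw [map_mul, map_ofNat]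
    change a + ι (r - 1 / k ^ 2) = ι (1 / k ^ 2) * _
    change _ = ι (1 / k ^ 2) * ((ι k - s) ^ 2 * (a + ι r) + ι (2 * k) * m +
      (ι (2 * k) - (s ^ 2 * a + 1)) + ι r * (s * (ι (2 * k) - s)))
    rw [e2, map_sub]
    linear_combination (-a - ι r) * e1 + ι (1 / k ^ 2) * (2 * ι k) * e
  obtain ⟨N, hN⟩ := harch (-a)
  have hbase : a + ι (max N 0) ∈ M := by
    have := hmono (le_max_left N 0) hN
    convert this using 1
    ring
  have hfin : ∀ r : ℝ, r ≤ 0 → a + ι r ∈ M → a ∈ M := by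
    intro r hr h
    have := hM.add_mem h (hM.algebraMap_mem (A := A) (r := -r) (by linarith))
    rw [map_neg] at this
    convert this using 1
    change a = a + ι r + -ι r
    ring
  have hiter : ∀ j : ℕ, a ∈ M ∨ a + ι (max N 0 - j * (1 / k ^ 2)) ∈ M := by
    intro j
    induction j with
    | zero => right; simpa using hbase
    | succ j ih =>
      rcases ih with h | h
      · exact Or.inl h
      · rcases le_total (max N 0 - j * (1 / k ^ 2)) 0 with h0 | h0
        · exact Or.inl (hfin _ h0 h)
        · right
          have := step _ h0 h
          convert this using 3
          push_cast
          ring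
  obtain ⟨j, hj⟩ := exists_nat_gt (max N 0 / (1 / k ^ 2))
  rw [div_lt_iff₀ (by positivity)] at hj
  rcases hiter j with h | h
  · exact h
  · exact hfin _ (by linarith) h

end Algebra

/-! ### Bounded elements and criteria for the archimedean property. -/

section Bounded

variable {A : Type*} [CommRing A] [Algebra ℝ A] {M : Set A}

/-- The square of `a` is bounded by a real number modulo `M`. -/
def Bounded (M : Set A) (a : A) : Prop :=
  ∃ N : ℝ, 0 ≤ N ∧ algebraMap ℝ A N - a ^ 2 ∈ M

theorem bounded_algebraMap (hM : IsQuadraticModule M) (r : ℝ) :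
    Bounded M (algebraMap ℝ A r) :=
  ⟨r ^ 2, sq_nonneg r, by rw [map_pow, sub_self]; exact hM.zero_mem⟩

theorem Bounded.add (hM : IsQuadraticModule M) {a b : A} (ha : Bounded M a) (hb : Bounded M b) :
    Bounded M (a + b) := by
  obtain ⟨N, hN, h⟩ := ha
  obtain ⟨N', hN', h'⟩ := hb
  refine ⟨2 * N + 2 * N', by positivity, ?_⟩
  convert hM.add_mem (hM.add_mem (hM.add_mem h h') (hM.add_mem h h')) (hM.pow_two_mem (a - b))
    using 1
  rw [map_add, map_mul, map_mul, map_ofNat]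
  ring

theorem Bounded.mul (hM : IsQuadraticModule M) {a b : A} (ha : Bounded M a) (hb : Bounded M b) :
    Bounded M (a * b) := by
  obtain ⟨N, hN, h⟩ := ha
  obtain ⟨N', hN', h'⟩ := hb
  refine ⟨N * N', by positivity, ?_⟩
  convert hM.add_mem (hM.smul_mem hN' h) (hM.sq_mul_mem a h') using 1
  rw [map_mul]
  ring

theorem Bounded.exists_sub_mem (hM : IsQuadraticModule M) {a : A} (ha : Bounded M a) :
    ∃ N : ℝ, algebraMap ℝ A N - a ∈ M := by
  obtain ⟨N, -, h⟩ := ha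
  refine ⟨N + (1 / 2) ^ 2, ?_⟩
  have e : algebraMap ℝ A (1 / 2) * 2 = 1 := by
    rw [← map_ofNat (algebraMap ℝ A) 2, ← map_mul]; norm_num
  convert hM.add_mem h (hM.pow_two_mem (a - algebraMap ℝ A (1 / 2))) using 1
  rw [map_add, map_pow]
  linear_combination a * e

theorem isArchimedeanModule_mvPolynomial {σ : Type*} {M : Set (MvPolynomial σ ℝ)}
    (hM : IsQuadraticModule M) (hX : ∀ i, Bounded M (MvPolynomial.X i)) :
    IsArchimedeanModule M := by
  intro a
  apply Bounded.exists_sub_mem hM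
  induction a using MvPolynomial.induction_on with
  | C r => exact hM.bounded_algebraMap r
  | add p q hp hq => exact hp.add hM hq
  | mul_X p i hp => exact hp.mul hM (hX i)

/-- Powers of a sum of squares are dominated by higher powers modulo `M`. -/
theorem exists_add_pow_succ_sub_pow_mem (hM : IsQuadraticModule M) {u : A} (hu : IsSumSq u)
    (k : ℕ) : ∀ ε : ℝ, 0 < ε → ∃ N : ℝ, 0 ≤ N ∧
      algebraMap ℝ A N + algebraMap ℝ A ε * u ^ (k + 1) - u ^ k ∈ M := by
  induction k with
  | zero =>
    intro ε hε
    refine ⟨1, zero_le_one, ?_⟩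
    convert hM.smul_mem hε.le (hM.sumSq_mem hu) using 1
    simp
  | succ k ih =>
    intro t ht
    obtain ⟨N, hN, h⟩ := ih t ht
    refine ⟨1 / t * N, by positivity, ?_⟩
    -- `u^k (tu - 1)² / t = t u^(k+2) - 2 u^(k+1) + u^k / t`; the induction hypothesis divided by
    -- `t` removes `u^k / t` at the cost of one `u^(k+1)`.
    have h1 := hM.smul_mem (r := 1 / t) (by positivity) (hM.sumSq_mul_mem (isSumSq_pow hu k)
      (hM.pow_two_mem (algebraMap ℝ A t * u - 1)))
    have h2 := hM.smul_mem (r := 1 / t) (by positivity) h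
    have e : algebraMap ℝ A (1 / t) * algebraMap ℝ A t = 1 := by
      rw [← map_mul, one_div_mul_cancel ht.ne', map_one]
    convert hM.add_mem h1 h2 using 1
    rw [map_mul]
    linear_combination (-(u ^ k) * (algebraMap ℝ A t * u ^ 2) + u ^ (k + 1)) * e

theorem exists_add_pow_sub_pow_mem (hM : IsQuadraticModule M) {u : A} (hu : IsSumSq u)
    (k j : ℕ) (ε : ℝ) (hε : 0 < ε) : ∃ N : ℝ, 0 ≤ N ∧
      algebraMap ℝ A N + algebraMap ℝ A ε * u ^ (k + j + 1) - u ^ k ∈ M := by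
  induction j with
  | zero => exact hM.exists_add_pow_succ_sub_pow_mem hu k ε hε
  | succ j ih =>
    obtain ⟨N, hN, h⟩ := ih
    obtain ⟨N', hN', h'⟩ := hM.exists_add_pow_succ_sub_pow_mem hu (k + j + 1) 1 one_pos
    refine ⟨N + ε * N', by positivity, ?_⟩
    convert hM.add_mem h (hM.smul_mem hε.le h') using 1
    rw [map_add, map_mul, map_one]
    ring

theorem exists_add_pow_sub_sum_mem (hM : IsQuadraticModule M) {u : A} (hu : IsSumSq u)
    (B : ℕ → ℝ) (hB : ∀ k, 0 ≤ B k) (m j : ℕ) (hj : j ≤ m) : ∀ ε : ℝ, 0 < ε → ∃ N : ℝ, 0 ≤ N ∧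
      algebraMap ℝ A N + algebraMap ℝ A ε * u ^ m -
        ∑ k ∈ Finset.range j, algebraMap ℝ A (B k) * u ^ k ∈ M := by
  have hpow : IsSumSq (u ^ m) := isSumSq_pow hu m
  induction j with
  | zero =>
    intro ε hε
    refine ⟨0, le_rfl, ?_⟩
    simpa using hM.smul_mem hε.le (hM.sumSq_mem hpow)
  | succ j ih =>
    intro ε hε
    obtain ⟨N, hN, h⟩ := ih (by omega) (ε / 2) (by positivity)
    have hBj : 0 < B j + 1 := by linarith [hB j]
    -- Half of `ε` pays for the earlier terms. After multiplication by `B j` the new term costs less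
    -- than `ε / 2`; the `+ 1` covers `B j = 0`, and `h''` adds back the unspent part.
    obtain ⟨N', hN', h'⟩ := hM.exists_add_pow_sub_pow_mem hu j (m - j - 1)
      (ε / (2 * (B j + 1))) (by positivity)
    rw [show j + (m - j - 1) + 1 = m by omega] at h'
    refine ⟨N + B j * N', by have := hB j; positivity, ?_⟩
    have h'' := hM.smul_mem (r := ε / 2 - B j * (ε / (2 * (B j + 1)))) (by
      rw [show ε / 2 - B j * (ε / (2 * (B j + 1))) = ε / (2 * (B j + 1)) by field_simp; ring]
      positivity) (hM.sumSq_mem hpow)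
    convert hM.add_mem (hM.add_mem h (hM.smul_mem (hB j) h')) h'' using 1
    rw [Finset.sum_range_succ, map_add, map_mul, map_sub, map_mul]
    have e : algebraMap ℝ A (ε / 2) * 2 = algebraMap ℝ A ε := by
      rw [← map_ofNat (algebraMap ℝ A) 2, ← map_mul]; norm_num
    linear_combination (-u ^ m) * e

/-- A sum of squares `u` is bounded modulo `M` if one of its powers is dominated by the lower
powers. -/
theorem exists_sub_mem_of_sum_sub_pow_mem (hM : IsQuadraticModule M) {u : A} (hu : IsSumSq u)
    (B : ℕ → ℝ) (hB : ∀ k, 0 ≤ B k) (m : ℕ) (hm : 1 ≤ m) (a : ℝ) (ha : 0 < a)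
    (h : ∑ k ∈ Finset.range m, algebraMap ℝ A (B k) * u ^ k - algebraMap ℝ A a * u ^ m ∈ M) :
    ∃ N : ℝ, algebraMap ℝ A N - u ∈ M := by
  -- With `ε = a / 2` the lower powers absorb only half of `a * u ^ m`, so `u ^ m`, and then `u`, is
  -- bounded.
  obtain ⟨N, -, h'⟩ := hM.exists_add_pow_sub_sum_mem hu B hB m m le_rfl (a / 2) (by positivity)
  have hpow : algebraMap ℝ A (2 / a * N) - u ^ m ∈ M := by
    convert hM.smul_mem (r := 2 / a) (by positivity) (hM.add_mem h h') using 1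
    have e1 : algebraMap ℝ A (2 / a) * algebraMap ℝ A a = 2 := by
      rw [← map_mul, div_mul_cancel₀ _ ha.ne', map_ofNat]
    have e2 : algebraMap ℝ A (2 / a) * algebraMap ℝ A (a / 2) = 1 := by
      rw [← map_mul, ← map_one (algebraMap ℝ A)]; congr 1; field_simp
    rw [map_mul]
    linear_combination (u ^ m) * e1 - (u ^ m) * e2
  rcases hm.eq_or_lt with rfl | hm
  · exact ⟨_, by rwa [pow_one] at hpow⟩
  · obtain ⟨N', -, h''⟩ := hM.exists_add_pow_sub_pow_mem hu 1 (m - 2) 1 one_pos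
    rw [show 1 + (m - 2) + 1 = m by omega] at h''
    refine ⟨N' + 2 / a * N, ?_⟩
    convert hM.add_mem hpow h'' using 1
    rw [map_add, map_one]
    ring

/-- A crude Cauchy-Schwarz inequality: iterating `(S + b)² ≤ 2 S² + 2 b²` costs a factor `2` per
term. -/
theorem sum_sq_sub_sq_sum_mem (hM : IsQuadraticModule M) (a : ℕ → A) (m : ℕ) :
    (2 : A) ^ m * ∑ k ∈ Finset.range m, a k ^ 2 - (∑ k ∈ Finset.range m, a k) ^ 2 ∈ M := by
  induction m with
  | zero => simpa using hM.zero_mem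
  | succ m ih =>
    rw [Finset.sum_range_succ, Finset.sum_range_succ]
    have hn : ((2 : A) ^ (m + 1) - 2) * a m ^ 2 ∈ M := by
      have : ((2 : A) ^ (m + 1) - 2) = algebraMap ℝ A (2 ^ (m + 1) - 2) := by
        rw [map_sub, map_pow, map_ofNat]
      rw [this]
      refine hM.smul_mem ?_ (hM.pow_two_mem _)
      have := pow_le_pow_right₀ (one_le_two (α := ℝ)) (show 1 ≤ m + 1 by omega)
      linarith
    convert hM.add_mem (hM.add_mem (hM.add_mem ih ih)
      (hM.pow_two_mem (∑ k ∈ Finset.range m, a k - a m))) hn using 1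
    ring

end Bounded

end IsQuadraticModule

open IsQuadraticModule

/-! ### Certificates on the root set. -/

theorem powParts_sq_add_sq {n : ℕ} (k : ℕ) :
    (powParts (n := n) k).1 ^ 2 + (powParts k).2 ^ 2 = (varX ^ 2 + varY ^ 2) ^ k := by
  induction k with
  | zero => simp [powParts]
  | succ k ih =>
    rw [pow_succ (varX ^ 2 + varY ^ 2), ← ih]
    simp only [powParts]
    ring

theorem isSumSq_varX_sq_add_varY_sq {n : ℕ} :
    IsSumSq (varX ^ 2 + varY ^ 2 : PolyQXY n) := by
  rw [pow_two, pow_two]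
  exact (IsSumSq.mul_self _).add (IsSumSq.mul_self _)

theorem liftQ_C {n : ℕ} (c : ℝ) :
    liftQ (MvPolynomial.C c : PolyQ n) = algebraMap ℝ (PolyQXY n) c := by
  simp [liftQ, MvPolynomial.algebraMap_eq]

/-- Bounded elements are closed under sums and products. This supplies the constants that bound the
coefficients of `f`. -/
theorem bounded_liftQ {n : ℕ} {M : Set (PolyQXY n)} (hM : IsQuadraticModule M)
    (hq : ∀ j, 1 - varQ j ^ 2 ∈ M) (c : PolyQ n) : Bounded M (liftQ c) := by
  induction c using MvPolynomial.induction_on with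
  | C r => rw [liftQ_C]; exact hM.bounded_algebraMap r
  | add p q hp hq =>
    have := hp.add hM hq
    rwa [liftQ, liftQ, ← map_add] at this
  | mul_X p i hp =>
    have hX : Bounded M (liftQ (MvPolynomial.X i)) :=
      ⟨1, zero_le_one, by simpa [liftQ, varQ] using hq i⟩
    have := hp.mul hM hX
    rwa [liftQ, liftQ, ← map_mul] at this

/-- A quadratic module that contains `1 - q_j ^ 2` for all `j` and the ideal generated by `f_ℜ` and
`f_ℑ` is archimedean, if the leading coefficient of `f` is a nonzero constant. -/
theorem isArchimedeanModule_of_mem {n : ℕ} {M : Set (PolyQXY n)} (hM : IsQuadraticModule M)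
    (hq : ∀ j, 1 - varQ j ^ 2 ∈ M) (f : Polynomial (PolyQ n)) {c : ℝ} (hc : c ≠ 0)
    (hf : f.leadingCoeff = MvPolynomial.C c) (hdeg : 1 ≤ f.natDegree)
    (hR : ∀ t, t * rePart f ∈ M) (hI : ∀ t, t * imPart f ∈ M) :
    IsArchimedeanModule M := by
  set m := f.natDegree with hm
  set u : PolyQXY n := varX ^ 2 + varY ^ 2 with hu
  have hus : IsSumSq u := isSumSq_varX_sq_add_varY_sq
  have hRe : rePart f = ∑ k ∈ Finset.range m, liftQ (f.coeff k) * (powParts k).1 +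
      algebraMap ℝ _ c * (powParts m).1 := by
    rw [rePart, Polynomial.sum_over_range _ (by simp [liftQ]), Finset.sum_range_succ, ← liftQ_C,
      ← hf, Polynomial.leadingCoeff]
  have hIm : imPart f = ∑ k ∈ Finset.range m, liftQ (f.coeff k) * (powParts k).2 +
      algebraMap ℝ _ c * (powParts m).2 := by
    rw [imPart, Polynomial.sum_over_range _ (by simp [liftQ]), Finset.sum_range_succ, ← liftQ_C,
      ← hf, Polynomial.leadingCoeff]
  choose B hB0 hB using fun k => bounded_liftQ hM hq (f.coeff k)
  have hbound : ∃ N : ℝ, algebraMap ℝ _ N - u ∈ M := by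
    refine hM.exists_sub_mem_of_sum_sub_pow_mem hus (fun k => 2 ^ m * B k)
      (fun k => by have := hB0 k; positivity) m hdeg (c ^ 2) (by positivity) ?_
    have h1 := hM.sum_sq_sub_sq_sum_mem (fun k => liftQ (f.coeff k) * (powParts k).1) m
    have h2 := hM.sum_sq_sub_sq_sum_mem (fun k => liftQ (f.coeff k) * (powParts k).2) m
    -- With `f_ℜ = S + c P`, where `S` collects the terms below the leading one, the multiplier `-(c
    -- P - S)` turns `f_ℜ` into `S² - c² P²`. So `S²` can be exchanged for the squared leading term,
    -- and the two parts together give `c² u^m`.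
    have h3 := hR (-(algebraMap ℝ _ c * (powParts m).1 -
      ∑ k ∈ Finset.range m, liftQ (f.coeff k) * (powParts k).1))
    have h4 := hI (-(algebraMap ℝ _ c * (powParts m).2 -
      ∑ k ∈ Finset.range m, liftQ (f.coeff k) * (powParts k).2))
    have h5 : ∑ k ∈ Finset.range m,
        algebraMap ℝ _ (2 ^ m) * ((algebraMap ℝ _ (B k) - liftQ (f.coeff k) ^ 2) * u ^ k) ∈ M := by
      refine hM.sum_mem _ _ fun k _ => hM.smul_mem (by positivity) ?_
      rw [mul_comm]
      exact hM.sumSq_mul_mem (isSumSq_pow hus k) (hB k)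
    convert hM.add_mem h5 (hM.add_mem (hM.add_mem h1 h2) (hM.add_mem h3 h4)) using 1
    have e1 : ∑ k ∈ Finset.range m,
        algebraMap ℝ _ (2 ^ m) * ((algebraMap ℝ _ (B k) - liftQ (f.coeff k) ^ 2) * u ^ k) =
        ∑ k ∈ Finset.range m, algebraMap ℝ _ (2 ^ m * B k) * u ^ k -
        2 ^ m * (∑ k ∈ Finset.range m, (liftQ (f.coeff k) * (powParts k).1) ^ 2 +
          ∑ k ∈ Finset.range m, (liftQ (f.coeff k) * (powParts k).2) ^ 2) := by
      rw [← Finset.sum_add_distrib, Finset.mul_sum, ← Finset.sum_sub_distrib]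
      refine Finset.sum_congr rfl fun k _ => ?_
      rw [hu, ← powParts_sq_add_sq k, map_mul, map_pow, map_ofNat]
      ring
    have e2 := powParts_sq_add_sq (n := n) m
    rw [e1, hRe, hIm, map_pow, hu, ← e2]
    ring
  obtain ⟨N, hN⟩ := hbound
  have hN' : algebraMap ℝ _ (max N 0) - u ∈ M := by
    have := hM.add_mem hN (hM.algebraMap_mem (A := PolyQXY n) (r := max N 0 - N) (by simp))
    rw [map_sub] at this
    convert this using 1
    ring
  refine isArchimedeanModule_mvPolynomial hM ?_
  rintro (j | i)
  · exact ⟨1, zero_le_one, by rw [map_one]; exact hq j⟩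
  · fin_cases i
    · refine ⟨max N 0, le_max_right _ _, ?_⟩
      convert hM.add_mem hN' (hM.pow_two_mem varY) using 1
      simp only [hu, varX]
      ring!
    · refine ⟨max N 0, le_max_right _ _, ?_⟩
      convert hM.add_mem hN' (hM.pow_two_mem varX) using 1
      simp only [hu, varY]
      ring!

/-- The quadratic module generated by `1 - q_j ^ 2`, `h`, `± f_ℜ` and `± f_ℑ`. -/
def certModule {n : ℕ} (f : Polynomial (PolyQ n)) (h : PolyQXY n) : Set (PolyQXY n) :=
  {g | ∃ (σ₀ : PolyQXY n) (σ : Fin n → PolyQXY n) (σh τR τI : PolyQXY n),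
    IsSumSq σ₀ ∧ (∀ j, IsSumSq (σ j)) ∧ IsSumSq σh ∧
    g = σ₀ + ∑ j, σ j * (1 - varQ j ^ 2) + σh * h + τR * rePart f + τI * imPart f}

theorem isQuadraticModule_certModule {n : ℕ} (f : Polynomial (PolyQ n)) (h : PolyQXY n) :
    IsQuadraticModule (certModule f h) where
  one_mem := ⟨1, 0, 0, 0, 0, IsSumSq.one, fun _ => IsSumSq.zero, IsSumSq.zero, by simp⟩
  add_mem := by
    rintro _ _ ⟨σ₀, σ, σh, τR, τI, h0, hσ, hh, rfl⟩ ⟨σ₀', σ', σh', τR', τI', h0', hσ', hh', rfl⟩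
    refine ⟨σ₀ + σ₀', σ + σ', σh + σh', τR + τR', τI + τI', h0.add h0',
      fun j => (hσ j).add (hσ' j), hh.add hh', ?_⟩
    simp only [Pi.add_apply, add_mul, Finset.sum_add_distrib]
    ring
  sq_mul_mem := by
    rintro a _ ⟨σ₀, σ, σh, τR, τI, h0, hσ, hh, rfl⟩
    have ha : IsSumSq (a ^ 2) := by rw [pow_two]; exact IsSumSq.mul_self a
    refine ⟨a ^ 2 * σ₀, fun j => a ^ 2 * σ j, a ^ 2 * σh, a ^ 2 * τR, a ^ 2 * τI, ha.mul h0,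
      fun j => ha.mul (hσ j), ha.mul hh, ?_⟩
    simp only [mul_assoc, ← Finset.mul_sum]
    ring

theorem one_sub_varQ_sq_mem_certModule {n : ℕ} (f : Polynomial (PolyQ n)) (h : PolyQXY n)
    (j : Fin n) : 1 - varQ j ^ 2 ∈ certModule f h := by
  refine ⟨0, Pi.single j 1, 0, 0, 0, IsSumSq.zero, fun i => ?_, IsSumSq.zero, ?_⟩
  · by_cases hij : i = j
    · subst hij; simp
    · rw [Pi.single_eq_of_ne hij]; exact IsSumSq.zero
  · simp [Pi.single_apply]

theorem mul_rePart_mem_certModule {n : ℕ} (f : Polynomial (PolyQ n)) (h t : PolyQXY n) :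
    t * rePart f ∈ certModule f h :=
  ⟨0, 0, 0, t, 0, IsSumSq.zero, fun _ => IsSumSq.zero, IsSumSq.zero, by simp⟩

theorem mul_imPart_mem_certModule {n : ℕ} (f : Polynomial (PolyQ n)) (h t : PolyQXY n) :
    t * imPart f ∈ certModule f h :=
  ⟨0, 0, 0, 0, t, IsSumSq.zero, fun _ => IsSumSq.zero, IsSumSq.zero, by simp⟩

theorem self_mem_certModule {n : ℕ} (f : Polynomial (PolyQ n)) (h : PolyQXY n) :
    h ∈ certModule f h :=
  ⟨0, 0, 1, 0, 0, IsSumSq.zero, fun _ => IsSumSq.zero, IsSumSq.one, by simp⟩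

theorem isArchimedeanModule_certModule {n : ℕ} (f : Polynomial (PolyQ n)) {c : ℝ} (hc : c ≠ 0)
    (hf : f.leadingCoeff = MvPolynomial.C c) (hdeg : 1 ≤ f.natDegree) (h : PolyQXY n) :
    IsArchimedeanModule (certModule f h) :=
  isArchimedeanModule_of_mem (isQuadraticModule_certModule f h)
    (one_sub_varQ_sq_mem_certModule f h) f hc hf hdeg (mul_rePart_mem_certModule f h)
    (mul_imPart_mem_certModule f h)

theorem evalQXY_nonneg_of_isSumSq {n : ℕ} {g : PolyQXY n} (hg : IsSumSq g) (q : Fin n → ℝ)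
    (x y : ℝ) : 0 ≤ evalQXY q x y g := by
  induction hg with
  | zero => simp [evalQXY]
  | sq_add a _ ih =>
    simp only [evalQXY, map_add, map_mul] at ih ⊢
    exact add_nonneg (mul_self_nonneg _) ih

theorem evalQXY_nonneg_of_mem_certModule {n : ℕ} {f : Polynomial (PolyQ n)} {h g : PolyQXY n}
    (hg : g ∈ certModule f h) {q : Fin n → ℝ} {x y : ℝ} (hz : (q, x, y) ∈ rootSet f)
    (hh : 0 ≤ evalQXY q x y h) : 0 ≤ evalQXY q x y g := by
  obtain ⟨σ₀, σ, σh, τR, τI, h0, hσ, hσh, rfl⟩ := hg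
  obtain ⟨hq, hR, hI⟩ := hz
  have h0' := evalQXY_nonneg_of_isSumSq h0 q x y
  have hσh' := evalQXY_nonneg_of_isSumSq hσh q x y
  have hσ' : ∀ j, 0 ≤ evalQXY q x y (σ j * (1 - varQ j ^ 2)) := by
    intro j
    have := evalQXY_nonneg_of_isSumSq (hσ j) q x y
    have hj := hq j
    simp only [Set.mem_Icc] at hj
    have e : evalQXY q x y (σ j * (1 - varQ j ^ 2)) = evalQXY q x y (σ j) * (1 - q j ^ 2) := by
      simp [evalQXY, varQ]
    rw [e]
    exact mul_nonneg this (by nlinarith)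
  simp only [evalQXY, map_add, map_mul, map_sum] at *
  rw [hR, hI]
  have := Finset.sum_nonneg fun j (_ : j ∈ Finset.univ) => hσ' j
  have := mul_nonneg hσh' hh
  linarith

/-- **Putinar's Positivstellensatz** for the root set of `f`, restricted by `h ≥ 0`. -/
theorem mem_certModule_of_pos {n : ℕ} (f : Polynomial (PolyQ n)) {c : ℝ} (hc : c ≠ 0)
    (hf : f.leadingCoeff = MvPolynomial.C c) (hdeg : 1 ≤ f.natDegree) (h g : PolyQXY n)
    (hpos : ∀ q x y, (q, x, y) ∈ rootSet f → 0 ≤ evalQXY q x y h → 0 < evalQXY q x y g) :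
    g ∈ certModule f h := by
  have hM := isQuadraticModule_certModule f h
  refine hM.mem_of_forall_algHom_pos (isArchimedeanModule_certModule f hc hf hdeg h) g ?_
  intro φ hφ
  set q : Fin n → ℝ := fun j => φ (varQ j)
  set x := φ varX
  set y := φ varY
  have hev : ∀ a, φ a = evalQXY q x y a := by
    have : φ = MvPolynomial.aeval (Sum.elim q ![x, y]) := by
      apply MvPolynomial.algHom_ext
      rintro (j | i)
      · simp [q, varQ]
      · fin_cases i <;> simp [x, y, varX, varY]
    intro a
    rw [this, evalQXY, MvPolynomial.aeval_eq_eval]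
  have hzero : ∀ a : PolyQXY n, (∀ t, t * a ∈ certModule f h) → φ a = 0 := by
    intro a ha
    have h1 := hφ _ (ha 1)
    have h2 := hφ _ (ha (-1))
    simp only [map_mul, map_one, map_neg] at h1 h2
    linarith
  have hz : (q, x, y) ∈ rootSet f := by
    refine ⟨fun j => ?_, ?_, ?_⟩
    · have := hφ _ (one_sub_varQ_sq_mem_certModule f h j)
      rw [map_sub, map_one, map_pow] at this
      exact abs_le.mp ((sq_le_one_iff_abs_le_one _).mp (by simpa using this))
    · rw [← hev]; exact hzero _ (mul_rePart_mem_certModule f h)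
    · rw [← hev]; exact hzero _ (mul_imPart_mem_certModule f h)
  rw [hev]
  exact hpos q x y hz (by rw [← hev]; exact hφ _ (self_mem_certModule f h))

/-! ### Fibres, roots and continuity of the abscissa. -/

/-- `f` is nonconstant in `s`, and its leading coefficient is a nonzero constant. -/
def HasConstantLead {n : ℕ} (f : Polynomial (PolyQ n)) : Prop :=
  1 ≤ f.natDegree ∧ ∃ c : ℝ, c ≠ 0 ∧ f.leadingCoeff = MvPolynomial.C c

theorem hasConstantLead_of_monic {n : ℕ} {p : Polynomial (PolyQ n)} (hp : p.Monic)
    (hm : 1 ≤ p.natDegree) : HasConstantLead p :=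
  ⟨hm, 1, one_ne_zero, by rw [hp.leadingCoeff, map_one]⟩

/-- The leading coefficient is the degree of `p`, not `1`; hence constant leads instead of monic
polynomials. -/
theorem hasConstantLead_derivative {n : ℕ} {p : Polynomial (PolyQ n)} (hp : p.Monic)
    (hm : 2 ≤ p.natDegree) : HasConstantLead p.derivative := by
  have hdeg : p.derivative.natDegree = p.natDegree - 1 :=
    Polynomial.natDegree_derivative p
  refine ⟨by omega, p.natDegree, by positivity, ?_⟩
  rw [Polynomial.leadingCoeff, hdeg, Polynomial.coeff_derivative,
    show p.natDegree - 1 + 1 = p.natDegree by omega, hp.coeff_natDegree, one_mul,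
    Nat.cast_sub (by omega)]
  simp

/-- The polynomial `f(q, ·)` over the complex numbers. -/
noncomputable def fiber {n : ℕ} (f : Polynomial (PolyQ n)) (q : Fin n → ℝ) : Polynomial ℂ :=
  f.map ((algebraMap ℝ ℂ).comp (MvPolynomial.eval q))

theorem evalC_eq_eval_fiber {n : ℕ} (f : Polynomial (PolyQ n)) (q : Fin n → ℝ) (s : ℂ) :
    evalC f q s = (fiber f q).eval s := by
  rw [fiber, Polynomial.eval_map, evalC]

namespace HasConstantLead

variable {n : ℕ} {f : Polynomial (PolyQ n)}

theorem natDegree_fiber (hf : HasConstantLead f) (q : Fin n → ℝ) :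
    (fiber f q).natDegree = f.natDegree := by
  obtain ⟨-, c, hc, h⟩ := hf
  exact Polynomial.natDegree_map_of_leadingCoeff_ne_zero _ (by simpa [h] using hc)

theorem exists_norm_leadingCoeff_fiber (hf : HasConstantLead f) :
    ∃ c : ℝ, 0 < c ∧ ∀ q : Fin n → ℝ, ‖(fiber f q).leadingCoeff‖ = c := by
  obtain ⟨-, c, hc, h⟩ := hf
  refine ⟨|c|, abs_pos.mpr hc, fun q => ?_⟩
  rw [fiber, Polynomial.leadingCoeff_map_of_leadingCoeff_ne_zero _ (by simpa [h] using hc), h]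
  simp

theorem fiber_ne_zero (hf : HasConstantLead f) (q : Fin n → ℝ) : fiber f q ≠ 0 := by
  intro h
  have h1 := hf.natDegree_fiber q
  rw [h, Polynomial.natDegree_zero] at h1
  have := hf.1
  omega

theorem degree_fiber_pos (hf : HasConstantLead f) (q : Fin n → ℝ) : 0 < (fiber f q).degree := by
  rw [← Polynomial.natDegree_pos_iff_degree_pos, hf.natDegree_fiber]
  exact hf.1

theorem isGreatest (hf : HasConstantLead f) (q : Fin n → ℝ) :
    IsGreatest {x : ℝ | ∃ s : ℂ, evalC f q s = 0 ∧ s.re = x} (abscissa f q) :=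
  isGreatest_abscissa f q (hf.degree_fiber_pos q).ne' (hf.fiber_ne_zero q)

theorem exists_root (hf : HasConstantLead f) (q : Fin n → ℝ) :
    ∃ s : ℂ, evalC f q s = 0 ∧ s.re = abscissa f q :=
  (hf.isGreatest q).1

theorem re_le_abscissa (hf : HasConstantLead f) {q : Fin n → ℝ} {s : ℂ}
    (hs : evalC f q s = 0) : s.re ≤ abscissa f q :=
  (hf.isGreatest q).2 ⟨s, hs, rfl⟩

/-- A point at which `f(q, ·)` is small is close to a root. -/
theorem exists_root_near (hf : HasConstantLead f) :
    ∃ c : ℝ, 0 < c ∧ ∀ (q : Fin n → ℝ) (z : ℂ) (ε : ℝ), 0 < ε →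
      ‖evalC f q z‖ < c * ε ^ f.natDegree → ∃ s, evalC f q s = 0 ∧ ‖z - s‖ < ε := by
  obtain ⟨c, hc, hlead⟩ := hf.exists_norm_leadingCoeff_fiber
  refine ⟨c, hc, fun q z ε hε h => ?_⟩
  by_contra! hcon
  have hs := IsAlgClosed.splits (fiber f q)
  have hcard : (fiber f q).roots.card = f.natDegree := by
    rw [← hf.natDegree_fiber q, ← hs.natDegree_eq_card_roots]
  -- The modulus of `f(q, z)` is `c` times the product of the distances from `z` to the roots.
  have hprod : ∀ t : Multiset ℂ, (∀ s ∈ t, ε ≤ ‖z - s‖) →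
      ε ^ t.card ≤ ‖(t.map fun s => z - s).prod‖ := by
    intro t
    induction t using Multiset.induction_on with
    | empty => simp
    | cons a t ih =>
      intro ht
      rw [Multiset.card_cons, Multiset.map_cons, Multiset.prod_cons, norm_mul, pow_succ']
      exact mul_le_mul (ht a (Multiset.mem_cons_self a t))
        (ih fun s hs => ht s (Multiset.mem_cons_of_mem hs)) (by positivity) (norm_nonneg _)
  have h1 := hprod (fiber f q).roots fun s hs => hcon s (by
    rw [evalC_eq_eval_fiber]
    exact (Polynomial.mem_roots'.mp hs).2)
  rw [evalC_eq_eval_fiber, hs.eval_eq_prod_roots, norm_mul, hlead] at h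
  rw [hcard] at h1
  exact absurd h (not_lt.mpr (mul_le_mul_of_nonneg_left h1 hc.le))

end HasConstantLead

theorem mem_rootSet_iff {n : ℕ} {f : Polynomial (PolyQ n)} {q : Fin n → ℝ} {x y : ℝ} :
    (q, x, y) ∈ rootSet f ↔ q ∈ box n ∧ evalC f q ⟨x, y⟩ = 0 := by
  rw [evalC_eq, Complex.ext_iff]
  rfl

theorem isCompact_box (n : ℕ) : IsCompact (box n) := by
  have : box n = Set.pi Set.univ fun _ => Set.Icc (-1 : ℝ) 1 := by
    ext q; simp only [box, Set.mem_ofPred_eq, Set.mem_univ_pi]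
  rw [this]
  exact isCompact_univ_pi fun _ => isCompact_Icc

theorem measurableSet_box (n : ℕ) : MeasurableSet (box n) :=
  (isCompact_box n).measurableSet

theorem continuous_evalC {n : ℕ} (f : Polynomial (PolyQ n)) :
    Continuous fun z : (Fin n → ℝ) × ℂ => evalC f z.1 z.2 := by
  simp only [evalC, Polynomial.eval₂_eq_sum_range]
  refine continuous_finsetSum _ fun k _ => Continuous.mul ?_ (by fun_prop)
  exact Complex.continuous_ofReal.comp
    ((MvPolynomial.continuous_eval (f.coeff k)).comp continuous_fst)

namespace HasConstantLead

variable {n : ℕ} {f : Polynomial (PolyQ n)}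

/-- The archimedean certificate for `x² + y²`, evaluated at a root, is a bound uniform in `q`. -/
theorem exists_norm_root_le (hf : HasConstantLead f) :
    ∃ R : ℝ, ∀ q ∈ box n, ∀ s, evalC f q s = 0 → ‖s‖ ≤ R := by
  obtain ⟨hdeg, c, hc, h⟩ := hf
  obtain ⟨N, hN⟩ := isArchimedeanModule_certModule f hc h hdeg 0 (varX ^ 2 + varY ^ 2)
  refine ⟨√N, fun q hq s hs => ?_⟩
  have := evalQXY_nonneg_of_mem_certModule hN (mem_rootSet_iff.mpr ⟨hq, hs⟩) (by simp [evalQXY])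
  simp only [evalQXY, varX, varY, map_sub, map_add, map_pow, MvPolynomial.algebraMap_eq,
    MvPolynomial.eval_C, MvPolynomial.eval_X, Sum.elim_inr, Matrix.cons_val_zero,
    Matrix.cons_val_one] at this
  refine Real.le_sqrt_of_sq_le ?_
  rw [← Complex.normSq_eq_norm_sq, Complex.normSq_apply]
  linarith

/-- By uniform continuity a rightmost root at `q₁` is nearly a root at a close `q₂`, hence near a
true root there. The resulting one-sided estimate is symmetric in the two parameters. -/
theorem continuousOn_abscissa (hf : HasConstantLead f) : ContinuousOn (abscissa f) (box n) := by
  obtain ⟨R, hR⟩ := hf.exists_norm_root_le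
  obtain ⟨c, hc, hnear⟩ := hf.exists_root_near
  have hcomp := (isCompact_box n).prod (isCompact_closedBall (0 : ℂ) R)
  have hunif := hcomp.uniformContinuousOn_of_continuous (continuous_evalC f).continuousOn
  rw [Metric.continuousOn_iff]
  intro q hq ε hε
  obtain ⟨δ, hδ, h⟩ := Metric.uniformContinuousOn_iff.mp hunif (c * ε ^ f.natDegree) (by positivity)
  have key : ∀ q₁ ∈ box n, ∀ q₂ ∈ box n, dist q₁ q₂ < δ → abscissa f q₁ < abscissa f q₂ + ε := by
    intro q₁ h₁ q₂ h₂ hd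
    obtain ⟨s, hs, hre⟩ := hf.exists_root q₁
    have hball : s ∈ Metric.closedBall (0 : ℂ) R := by simpa using hR q₁ h₁ s hs
    have h' := h (q₁, s) ⟨h₁, hball⟩ (q₂, s) ⟨h₂, hball⟩ (by simpa [Prod.dist_eq] using hd)
    simp only [hs, dist_zero_left] at h'
    obtain ⟨t, ht, hst⟩ := hnear q₂ s ε hε h'
    have h1 := hf.re_le_abscissa ht
    have h2 := (Complex.re_le_norm (s - t)).trans_lt hst
    rw [Complex.sub_re] at h2
    linarith
  refine ⟨δ, hδ, fun q' hq' hd => ?_⟩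
  rw [Real.dist_eq, abs_lt]
  have h1 := key q' hq' q hq hd
  have h2 := key q hq q' hq' (by rwa [dist_comm])
  constructor <;> linarith

end HasConstantLead

/-- A consequence of the Gauss-Lucas theorem. -/
theorem abscissa_derivative_le {n : ℕ} {p : Polynomial (PolyQ n)} (hp : HasConstantLead p)
    (hp' : HasConstantLead p.derivative) (q : Fin n → ℝ) :
    abscissa p.derivative q ≤ abscissa p q := by
  obtain ⟨s, hs, hre⟩ := hp'.exists_root q
  have hfib : fiber p.derivative q = (fiber p q).derivative := by
    rw [fiber, fiber, Polynomial.derivative_map]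
  have hmem : s ∈ convexHull ℝ ((fiber p q).rootSet ℂ) := by
    apply Polynomial.rootSet_derivative_subset_convexHull_rootSet (hp.degree_fiber_pos q)
    rw [← hfib, Polynomial.mem_rootSet]
    refine ⟨hp'.fiber_ne_zero q, ?_⟩
    rw [Polynomial.coe_aeval_eq_eval, ← evalC_eq_eval_fiber, hs]
  have hconv : Convex ℝ {z : ℂ | z.re ≤ abscissa p q} :=
    convex_halfSpace_re_le _
  rw [← hre]
  refine convexHull_min ?_ hconv hmem
  intro z hz
  refine hp.re_le_abscissa ?_
  rw [evalC_eq_eval_fiber, ← Polynomial.coe_aeval_eq_eval]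
  exact (Polynomial.mem_rootSet.mp hz).2

/-! ### Polynomial approximation, null zero sets and rigidity of the abscissa. -/

/-- Polynomials approximate continuous functions uniformly on compact sets. -/
theorem exists_mvPolynomial_near_of_continuousOn {n : ℕ} {K : Set (Fin n → ℝ)} (hK : IsCompact K)
    {g : (Fin n → ℝ) → ℝ} (hg : ContinuousOn g K) {ε : ℝ} (hε : 0 < ε) :
    ∃ v : MvPolynomial (Fin n) ℝ, ∀ q ∈ K, |MvPolynomial.eval q v - g q| < ε := by
  have : CompactSpace K := isCompact_iff_compactSpace.mp hK
  let Φ : MvPolynomial (Fin n) ℝ →ₐ[ℝ] C(K, ℝ) :=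
    MvPolynomial.aeval fun j => ⟨fun q => q.1 j, (continuous_apply j).comp continuous_subtype_val⟩
  have hΦ : ∀ v (q : K), Φ v q = MvPolynomial.eval q.1 v := by
    intro v q
    induction v using MvPolynomial.induction_on with
    | C r => simp [Φ]
    | add a b ha hb => rw [map_add, ContinuousMap.add_apply, ha, hb, map_add]
    | mul_X a j ha =>
      rw [map_mul, ContinuousMap.mul_apply, ha, map_mul, MvPolynomial.eval_X]
      simp [Φ]
  have hsep : Φ.range.SeparatesPoints := by
    intro a b hab
    obtain ⟨j, hj⟩ := Function.ne_iff.mp (Subtype.coe_ne_coe.mpr hab)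
    refine ⟨_, ⟨Φ (MvPolynomial.X j), ⟨_, rfl⟩, rfl⟩, ?_⟩
    simpa [hΦ] using hj
  obtain ⟨⟨_, v, rfl⟩, hv⟩ :=
    ContinuousMap.exists_mem_subalgebra_near_continuous_of_separatesPoints Φ.range hsep
      (K.domRestrict g) hg.domRestrict ε hε
  refine ⟨v, fun q hq => ?_⟩
  have := hv ⟨q, hq⟩
  rw [Real.norm_eq_abs] at this
  have e := hΦ v ⟨q, hq⟩
  rwa [← e]

/-- The zero set of a nonzero real polynomial is a null set. -/
theorem volume_setOf_eval_eq_zero {n : ℕ} {P : MvPolynomial (Fin n) ℝ} (hP : P ≠ 0) :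
    volume {q : Fin n → ℝ | MvPolynomial.eval q P = 0} = 0 := by
  induction n with
  | zero =>
    have : {q : Fin 0 → ℝ | MvPolynomial.eval q P = 0} = ∅ := by
      ext q
      simp only [Set.mem_ofPred_eq, Set.mem_empty_iff_false, iff_false]
      intro h
      apply hP
      apply MvPolynomial.funext
      intro q'
      rw [Subsingleton.elim q' q, h, map_zero]
    rw [this, measure_empty]
  | succ n ih =>
    let e := (MeasurableEquiv.piFinSuccAbove (fun _ : Fin (n + 1) => ℝ) 0).symm
    have he : MeasurePreserving e :=
      (volume_preserving_piFinSuccAbove (fun _ : Fin (n + 1) => ℝ) 0).symm _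
    have hms : MeasurableSet {q : Fin (n + 1) → ℝ | MvPolynomial.eval q P = 0} :=
      (isClosed_eq (MvPolynomial.continuous_eval P) continuous_const).measurableSet
    have hQ : MvPolynomial.finSuccEquiv ℝ n P ≠ 0 := by
      simpa using hP
    rw [← he.measure_preimage hms.nullMeasurableSet, Measure.volume_eq_prod,
      Measure.prod_apply_symm (e.measurable hms), lintegral_eq_zero_iff
        (measurable_measure_prodMk_right (e.measurable hms))]
    -- Fubini: where the leading coefficient in the first variable does not vanish, the slice is
    -- finite.
    have hae : ∀ᵐ y : Fin n → ℝ,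
        MvPolynomial.eval y (MvPolynomial.finSuccEquiv ℝ n P).leadingCoeff ≠ 0 := by
      rw [ae_iff]
      simpa using ih (Polynomial.leadingCoeff_ne_zero.mpr hQ)
    filter_upwards [hae] with y hy
    have hy' : (MvPolynomial.finSuccEquiv ℝ n P).map (MvPolynomial.eval y) ≠ 0 := by
      intro h
      apply hy
      rw [Polynomial.leadingCoeff, ← Polynomial.coeff_map, h, Polynomial.coeff_zero]
    refine ((Polynomial.finite_setOfPred_isRoot hy').subset ?_).measure_zero _
    intro t ht
    have ht' : MvPolynomial.eval (Fin.cons t y : Fin (n + 1) → ℝ) P = 0 := by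
      have : e (t, y) = Fin.cons t y := by
        simp [e, MeasurableEquiv.piFinSuccAbove, Fin.consEquiv]
      rw [← this]
      exact ht
    rw [MvPolynomial.eval_eq_eval_mv_eval'] at ht'
    exact ht'

theorem evalC_conj {n : ℕ} (f : Polynomial (PolyQ n)) (q : Fin n → ℝ) (s : ℂ) :
    evalC f q (starRingEnd ℂ s) = starRingEnd ℂ (evalC f q s) := by
  rw [evalC, evalC, Polynomial.hom_eval₂]
  congr 1
  ext <;> simp

/-- If the abscissa of `f` coincides with a polynomial on a set of positive measure, then it is
bounded below by this polynomial everywhere. -/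
theorem HasConstantLead.eval_le_abscissa {n : ℕ} {f : Polynomial (PolyQ n)}
    (hf : HasConstantLead f) (v : PolyQ n) {S : Set (Fin n → ℝ)} (hS : volume S ≠ 0)
    (h : ∀ q ∈ S, MvPolynomial.eval q v = abscissa f q) (q : Fin n → ℝ) :
    MvPolynomial.eval q v ≤ abscissa f q := by
  set m := f.natDegree
  let G₁ := f.comp (Polynomial.X + Polynomial.C v)
  let G₂ := f.comp (-Polynomial.X + Polynomial.C v)
  let ψ : (Fin n → ℝ) → PolyQ n →+* ℂ := fun q => (algebraMap ℝ ℂ).comp (MvPolynomial.eval q)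
  have hψ : ∀ q, ψ q v = (MvPolynomial.eval q v : ℝ) := fun q => rfl
  have h1 : ∀ q, G₁.map (ψ q) = (fiber f q).comp (Polynomial.X + Polynomial.C (ψ q v)) := by
    intro q
    simp [G₁, fiber, ψ, Polynomial.map_comp]
  have h2 : ∀ q, G₂.map (ψ q) = (fiber f q).comp (-Polynomial.X + Polynomial.C (ψ q v)) := by
    intro q
    simp [G₂, fiber, ψ, Polynomial.map_comp]
  have hd1 : ∀ q, (G₁.map (ψ q)).natDegree = m := by
    intro q
    rw [h1, Polynomial.natDegree_comp, Polynomial.natDegree_X_add_C, mul_one, hf.natDegree_fiber]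
  have hd2 : ∀ q, (G₂.map (ψ q)).natDegree = m := by
    intro q
    rw [h2, Polynomial.natDegree_comp, Polynomial.natDegree_add_C, Polynomial.natDegree_neg,
      Polynomial.natDegree_X, mul_one, hf.natDegree_fiber]
  -- Both polynomials keep degree `m` in every fibre, so the resultant commutes with specialisation
  -- and detects a common root `t`.
  have hres : ∀ q, ψ q (Polynomial.resultant G₁ G₂ m m) = 0 ↔
      ∃ t : ℂ, evalC f q (t + MvPolynomial.eval q v) = 0 ∧
        evalC f q (-t + MvPolynomial.eval q v) = 0 := by
    intro q
    have hne : G₁.map (ψ q) ≠ 0 := by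
      intro h0
      have := hd1 q
      rw [h0, Polynomial.natDegree_zero] at this
      have := hf.1
      omega
    have e : ψ q (Polynomial.resultant G₁ G₂ m m) =
        Polynomial.resultant (G₁.map (ψ q)) (G₂.map (ψ q)) := by
      rw [hd1, hd2, Polynomial.resultant_map_map]
    rw [e, Polynomial.resultant_eq_zero_iff, and_iff_right (Or.inl hne),
      Polynomial.isCoprime_iff_aeval_ne_zero_of_isAlgClosed ℂ ℂ]
    push Not
    refine exists_congr fun t => ?_
    rw [h1, h2, evalC_eq_eval_fiber, evalC_eq_eval_fiber, hψ]
    simp [Polynomial.coe_aeval_eq_eval]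
  have hzero : Polynomial.resultant G₁ G₂ m m = 0 := by
    by_contra hne
    refine hS (measure_mono_null ?_ (volume_setOf_eval_eq_zero hne))
    intro q hq
    have hq' : ψ q (Polynomial.resultant G₁ G₂ m m) = 0 := by
      rw [hres]
      obtain ⟨s, hs, hre⟩ := hf.exists_root q
      -- As `Re s = v(q)` on `S`, this `t` is purely imaginary and `v(q) - t` is the conjugate root.
      refine ⟨s - MvPolynomial.eval q v, by simpa using hs, ?_⟩
      have hconj := evalC_conj f q s
      rw [hs, map_zero] at hconj
      rw [← hconj, h q hq, ← hre]
      congr 1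
      apply Complex.ext <;> simp
    simpa [ψ] using hq'
  obtain ⟨t, ht1, ht2⟩ := (hres q).mp (by rw [hzero, map_zero])
  have e1 := hf.re_le_abscissa ht1
  have e2 := hf.re_le_abscissa ht2
  simp only [Complex.add_re, Complex.neg_re, Complex.ofReal_re] at e1 e2
  linarith

/-! ### Degree bounds, evaluation and integrability. -/

theorem DegLE.mono {σ : Type} {g : MvPolynomial σ ℝ} {k l : ℤ} (h : DegLE g k) (hkl : k ≤ l) :
    DegLE g l :=
  h.imp_right fun h => h.trans hkl

theorem SosLE.mono {σ : Type} {g : MvPolynomial σ ℝ} {k l : ℤ} (h : SosLE g k) (hkl : k ≤ l) :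
    SosLE g l :=
  ⟨h.1, h.2.mono hkl⟩

theorem evalQXY_liftQ {n : ℕ} (q : Fin n → ℝ) (x y : ℝ) (v : PolyQ n) :
    evalQXY q x y (liftQ v) = MvPolynomial.eval q v := by
  simp only [evalQXY, liftQ, MvPolynomial.eval_rename]
  rfl

theorem evalQXY_varX {n : ℕ} (q : Fin n → ℝ) (x y : ℝ) : evalQXY q x y varX = x := by
  simp [evalQXY, varX]

theorem evalQXY_sub {n : ℕ} (q : Fin n → ℝ) (x y : ℝ) (g h : PolyQXY n) :
    evalQXY q x y (g - h) = evalQXY q x y g - evalQXY q x y h := by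
  simp [evalQXY]

section Integration

variable {n : ℕ} {f : Polynomial (PolyQ n)}

theorem integrableOn_eval (v : PolyQ n) :
    IntegrableOn (fun q => MvPolynomial.eval q v) (box n) :=
  (MvPolynomial.continuous_eval v).continuousOn.integrableOn_compact (isCompact_box n)

theorem HasConstantLead.integrableOn_abscissa (hf : HasConstantLead f) :
    IntegrableOn (abscissa f) (box n) :=
  hf.continuousOn_abscissa.integrableOn_compact (isCompact_box n)

theorem HasConstantLead.measurable_indicator_abscissa (hf : HasConstantLead f) :
    Measurable ((box n).indicator (abscissa f)) := by
  classical
  rw [← Set.piecewise_eq_indicator]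
  exact hf.continuousOn_abscissa.measurable_piecewise continuousOn_const (measurableSet_box n)

theorem eLpNorm_one_eq_ofReal_integral {α : Type*} [MeasurableSpace α] {μ : Measure α} {g : α → ℝ}
    (hg : Integrable g μ) (h0 : 0 ≤ᵐ[μ] g) :
    eLpNorm g 1 μ = ENNReal.ofReal (∫ a, g a ∂μ) := by
  rw [eLpNorm_one_eq_lintegral_enorm, ← ofReal_integral_norm_eq_lintegral_enorm hg]
  congr 1
  refine integral_congr_ae ?_
  filter_upwards [h0] with a ha
  exact Real.norm_of_nonneg ha

end Integration

/-! ### Convergence of the upper programs. -/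

section Upper

variable {n : ℕ} {f : Polynomial (PolyQ n)}

theorem UpperFeasible.mem_certModule {d : ℕ} {v : PolyQ n} (h : UpperFeasible f d v) :
    liftQ v - varX ∈ certModule f 0 := by
  obtain ⟨-, σ₀, σ, τR, τI, h0, hσ, -, -, e⟩ := h
  exact ⟨σ₀, σ, 0, τR, τI, h0.1, fun j => (hσ j).1, IsSumSq.zero, by rw [e]; ring⟩

theorem UpperFeasible.mono {d d' : ℕ} {v : PolyQ n} (h : UpperFeasible f d v) (hd : d ≤ d') :
    UpperFeasible f d' v := by
  obtain ⟨hv, σ₀, σ, τR, τI, h0, hσ, hR, hI, e⟩ := h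
  have hd' : (d : ℤ) ≤ d' := by exact_mod_cast hd
  exact ⟨hv.mono (by linarith), σ₀, σ, τR, τI, h0.mono (by linarith),
    fun j => (hσ j).mono (by linarith), hR.mono (by linarith), hI.mono (by linarith), e⟩

theorem exists_upperFeasible_of_mem_certModule {v : PolyQ n}
    (h : liftQ v - varX ∈ certModule f 0) : ∃ d₀, ∀ d ≥ d₀, UpperFeasible f d v := by
  obtain ⟨σ₀, σ, σh, τR, τI, h0, hσ, -, e⟩ := h
  refine ⟨v.totalDegree + σ₀.totalDegree + ∑ j, (σ j).totalDegree + τR.totalDegree +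
    τI.totalDegree + f.natDegree + 1, fun d hd => ?_⟩
  have hj : ∀ j, (σ j).totalDegree ≤ ∑ j, (σ j).totalDegree := fun j =>
    Finset.single_le_sum (f := fun j => (σ j).totalDegree) (fun _ _ => Nat.zero_le _)
      (Finset.mem_univ j)
  refine ⟨Or.inr (by omega), σ₀, σ, τR, τI, ⟨h0, Or.inr (by omega)⟩,
    fun j => ⟨hσ j, Or.inr ?_⟩, Or.inr (by omega), Or.inr (by omega), by rw [e]; ring⟩
  have := hj j
  omega

theorem UpperFeasible.abscissa_le (hf : HasConstantLead f) {d : ℕ} {v : PolyQ n}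
    (h : UpperFeasible f d v) {q : Fin n → ℝ} (hq : q ∈ box n) :
    abscissa f q ≤ MvPolynomial.eval q v := by
  obtain ⟨s, hs, hre⟩ := hf.exists_root q
  have := evalQXY_nonneg_of_mem_certModule h.mem_certModule (mem_rootSet_iff.mpr ⟨hq, hs⟩)
    (by simp [evalQXY])
  rw [evalQXY_sub, evalQXY_liftQ, evalQXY_varX] at this
  linarith

/-- Approximating `a_f + ε/2` to within `ε/2` keeps `v` strictly above `a_f`, as Putinar's theorem
requires. -/
theorem exists_upperFeasible_near (hf : HasConstantLead f) {ε : ℝ} (hε : 0 < ε) :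
    ∃ (v : PolyQ n) (d₀ : ℕ), (∀ d ≥ d₀, UpperFeasible f d v) ∧
      ∀ q ∈ box n, MvPolynomial.eval q v ≤ abscissa f q + ε := by
  obtain ⟨v, hv⟩ := exists_mvPolynomial_near_of_continuousOn (isCompact_box n)
    (hf.continuousOn_abscissa.add (continuousOn_const (c := ε / 2))) (half_pos hε)
  have hmem : liftQ v - varX ∈ certModule f 0 := by
    obtain ⟨hdeg, c, hc, hlead⟩ := id hf
    refine mem_certModule_of_pos f hc hlead hdeg _ _ fun q x y hz _ => ?_
    rw [mem_rootSet_iff] at hz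
    have h1 := (abs_lt.mp (hv q hz.1)).1
    have h2 := hf.re_le_abscissa hz.2
    rw [evalQXY_sub, evalQXY_liftQ, evalQXY_varX]
    simp only [Pi.add_apply] at h1
    linarith
  obtain ⟨d₀, hd₀⟩ := exists_upperFeasible_of_mem_certModule hmem
  refine ⟨v, d₀, hd₀, fun q hq => ?_⟩
  have h1 := (abs_lt.mp (hv q hq)).2
  simp only [Pi.add_apply] at h1
  linarith

theorem UpperFeasible.integral_abscissa_le (hf : HasConstantLead f) {d : ℕ} {v : PolyQ n}
    (h : UpperFeasible f d v) :
    ∫ q in box n, abscissa f q ≤ ∫ q in box n, MvPolynomial.eval q v :=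
  setIntegral_mono_on hf.integrableOn_abscissa (integrableOn_eval v) (measurableSet_box n)
    fun _ hq => h.abscissa_le hf hq

theorem bddBelow_upperValue (hf : HasConstantLead f) (d : ℕ) :
    BddBelow {r : ℝ | ∃ v : PolyQ n, UpperFeasible f d v ∧
      r = ∫ q in box n, MvPolynomial.eval q v} :=
  ⟨∫ q in box n, abscissa f q, by rintro _ ⟨v, hv, rfl⟩; exact hv.integral_abscissa_le hf⟩

theorem exists_upperNearOptimal (hf : HasConstantLead f) :
    ∃ d₀, ∀ d ≥ d₀, ∃ v, UpperNearOptimal f d v := by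
  obtain ⟨v, d₀, hv, -⟩ := exists_upperFeasible_near hf one_pos
  -- The `+ 1` excludes order `0`, where `1 / d` is `0` and leaves no slack above the infimum.
  refine ⟨d₀ + 1, fun d hd => ?_⟩
  have hd0 : (0 : ℝ) < 1 / d := by
    have : 0 < d := by omega
    positivity
  obtain ⟨_, ⟨u, hu, rfl⟩, hlt⟩ := exists_lt_of_csInf_lt
    (s := {r : ℝ | ∃ v : PolyQ n, UpperFeasible f d v ∧
      r = ∫ q in box n, MvPolynomial.eval q v})
    ⟨_, v, hv d (by omega), rfl⟩ (lt_add_of_pos_right _ hd0)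
  exact ⟨u, hu, hlt.le⟩

/-- Near optimal solutions of the upper programs converge to the abscissa in mean. -/
theorem tendsto_eLpNorm_upper (hf : HasConstantLead f) (v : ℕ → PolyQ n) (k : ℕ → ℕ)
    (hk : Tendsto k atTop atTop) (hv : ∀ l, UpperNearOptimal f (k l) (v l)) :
    Tendsto (fun l => eLpNorm ((fun q => MvPolynomial.eval q (v l)) - abscissa f) 1
      (volume.restrict (box n))) atTop (𝓝 0) := by
  have hint : ∀ l, Integrable ((fun q => MvPolynomial.eval q (v l)) - abscissa f)
      (volume.restrict (box n)) := fun l =>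
    (integrableOn_eval (v l)).sub hf.integrableOn_abscissa
  have hnn : ∀ l, 0 ≤ᵐ[volume.restrict (box n)]
      ((fun q => MvPolynomial.eval q (v l)) - abscissa f) := by
    intro l
    filter_upwards [ae_restrict_mem (measurableSet_box n)] with q hq
    exact sub_nonneg.mpr ((hv l).1.abscissa_le hf hq)
  simp_rw [fun l => eLpNorm_one_eq_ofReal_integral (hint l) (hnn l)]
  rw [← ENNReal.ofReal_zero]
  refine ENNReal.tendsto_ofReal ?_
  rw [Metric.tendsto_atTop]
  intro ε hε
  set V := volume.real (box n)
  have hV : 0 ≤ V := measureReal_nonneg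
  -- Integrated over the box this error is at most `ε / 2`; the other half is for the slack `1 / k
  -- l`.
  obtain ⟨u, d₀, hu, hle⟩ := exists_upperFeasible_near hf (ε := ε / (2 * (V + 1)))
    (by positivity)
  obtain ⟨d₁, hd₁⟩ := exists_nat_gt (2 / ε)
  obtain ⟨L, hL⟩ := eventually_atTop.mp ((tendsto_atTop.mp hk) (d₀ + d₁ + 1))
  refine ⟨L, fun l hl => ?_⟩
  have hkl := hL l hl
  have h1 : ∫ q in box n, MvPolynomial.eval q u ≤
      (∫ q in box n, abscissa f q) + ε / (2 * (V + 1)) * V := by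
    have := setIntegral_mono_on (integrableOn_eval u)
      (hf.integrableOn_abscissa.add (integrableOn_const (C := ε / (2 * (V + 1)))
        (isCompact_box n).measure_lt_top.ne)) (measurableSet_box n) hle
    simp only [Pi.add_apply] at this
    rw [integral_add hf.integrableOn_abscissa
      (integrableOn_const (isCompact_box n).measure_lt_top.ne), setIntegral_const] at this
    simpa [mul_comm] using this
  have h2 : upperValue f (k l) ≤ ∫ q in box n, MvPolynomial.eval q u :=
    csInf_le (bddBelow_upperValue hf _) ⟨u, hu _ (by omega), rfl⟩
  have h3 := (hv l).2
  have h4 : 1 / (k l : ℝ) < ε / 2 := by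
    have : (d₁ : ℝ) ≤ k l := by exact_mod_cast (show d₁ ≤ k l by omega)
    have hpos : (0 : ℝ) < 2 / ε := by positivity
    rw [div_lt_iff₀ (by linarith)]
    have := (div_lt_iff₀ hε).mp (hd₁.trans_le this)
    linarith
  have h5 : ε / (2 * (V + 1)) * V ≤ ε / 2 := by
    rw [div_mul_eq_mul_div, div_le_div_iff₀ (by positivity) (by positivity)]
    nlinarith
  have h6 : 0 ≤ ∫ q in box n, ((fun q => MvPolynomial.eval q (v l)) - abscissa f) q :=
    integral_nonneg_of_ae (hnn l)
  rw [Real.dist_eq, sub_zero, abs_of_nonneg h6]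
  have h7 : ∫ q in box n, ((fun q => MvPolynomial.eval q (v l)) - abscissa f) q =
      (∫ q in box n, MvPolynomial.eval q (v l)) - ∫ q in box n, abscissa f q :=
    integral_sub (integrableOn_eval (v l)) hf.integrableOn_abscissa
  rw [h7]
  linarith

end Upper

/-! ### Upper bounds below the abscissa of `p` off a small set. -/

section Sequence

variable {n : ℕ} {p : Polynomial (PolyQ n)}

/-- The upper bounds for `a_{p'}` can be chosen below `a_p` outside a small set, if the set `D` is a
null set. -/
theorem exists_upper_sequence_of_null (hp : HasConstantLead p) (hp' : HasConstantLead p.derivative)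
    (hD : volume (coincidenceSet p) = 0) {δ : ℝ} (hδ : 0 < δ) :
    ∃ A : Set (Fin n → ℝ), IsSmallSet δ A ∧
      ∃ (k : ℕ → ℕ) (v : ℕ → PolyQ n), StrictMono k ∧
        (∀ l, UpperNearOptimal p.derivative (k l) (v l)) ∧
        TendstoUniformlyOn (fun l q => MvPolynomial.eval q (v l)) (abscissa p.derivative)
          atTop (box n \ A) ∧
        ∀ l, ∀ q ∈ box n \ A, MvPolynomial.eval q (v l) ≤ abscissa p q := by
  have hbox := measurableSet_box n
  obtain ⟨d₀, hd₀⟩ := exists_upperNearOptimal hp'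
  choose u hu using fun l : ℕ => hd₀ (d₀ + l) (Nat.le_add_right _ _)
  set μ := (volume : Measure (Fin n → ℝ)).restrict (box n) with hμ
  have : IsFiniteMeasure μ := ⟨by
    rw [hμ, Measure.restrict_apply_univ]; exact (isCompact_box n).measure_lt_top⟩
  have hmeas : ∀ l, StronglyMeasurable fun q => MvPolynomial.eval q (u l) := fun l =>
    (MvPolynomial.continuous_eval (u l)).stronglyMeasurable
  obtain ⟨ns, hns, hae⟩ := (tendstoInMeasure_of_tendsto_eLpNorm one_ne_zero
    (fun l => (hmeas l).aestronglyMeasurable) hp'.integrableOn_abscissa.aestronglyMeasurable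
    (tendsto_eLpNorm_upper hp' u (fun l => d₀ + l)
      (tendsto_atTop_mono (fun l => Nat.le_add_left _ _) tendsto_id) hu)).exists_seq_tendsto_ae
  -- Egorov's theorem. Continuity of the abscissa is known only on the box, so its indicator
  -- extension supplies global measurability.
  obtain ⟨t, ht, hμt, hunif⟩ := tendstoUniformlyOn_of_ae_tendsto' (μ := μ)
    (g := (box n).indicator (abscissa p.derivative))
    (fun i => hmeas (ns i)) hp'.measurable_indicator_abscissa.stronglyMeasurable
    (by
      filter_upwards [hae, ae_restrict_mem hbox] with q hq hqb
      rwa [Set.indicator_of_mem hqb]) (ε := δ / 3) (by positivity)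
  let E : ℕ → Set (Fin n → ℝ) := fun j =>
    {q | q ∈ box n ∧ abscissa p q - abscissa p.derivative q < 1 / ((j : ℝ) + 1)}
  have hEmeas : ∀ j, MeasurableSet (E j) := by
    intro j
    have : E j = box n ∩ {q | (box n).indicator (abscissa p) q -
        (box n).indicator (abscissa p.derivative) q < 1 / ((j : ℝ) + 1)} := by
      ext q
      refine and_congr_right fun hq => ?_
      simp only [Set.mem_ofPred_eq, Set.indicator_of_mem hq]
    rw [this]
    exact hbox.inter (measurableSet_lt
      (hp.measurable_indicator_abscissa.sub hp'.measurable_indicator_abscissa) measurable_const)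
  have hEanti : Antitone E := by
    intro i j hij q hq
    refine ⟨hq.1, hq.2.trans_le ?_⟩
    exact one_div_le_one_div_of_le (by positivity) (by gcongr)
  have hEinter : ⋂ j, E j ⊆ coincidenceSet p := by
    intro q hq
    rw [Set.mem_iInter] at hq
    refine ⟨(hq 0).1, le_antisymm ?_ (abscissa_derivative_le hp hp' q)⟩
    rw [← sub_nonpos]
    refine le_of_forall_pos_lt_add fun ε hε => ?_
    obtain ⟨j, hj⟩ := exists_nat_one_div_lt hε
    rw [zero_add]
    exact (hq j).2.trans hj
  -- The sets `E j` decrease into the null set `D`, so continuity from above applies.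
  obtain ⟨j, hj⟩ : ∃ j, volume (E j) < ENNReal.ofReal (δ / 3) := by
    have htend := tendsto_measure_iInter_atTop (μ := volume)
      (fun j => (hEmeas j).nullMeasurableSet) hEanti
      ⟨0, ((measure_mono fun q hq => hq.1).trans_lt (isCompact_box n).measure_lt_top).ne⟩
    rw [measure_mono_null hEinter hD] at htend
    exact (htend.eventually_lt_const (ENNReal.ofReal_pos.mpr (by positivity))).exists
  have hpos : (0 : ℝ) < 1 / ((j : ℝ) + 1) := by positivity
  -- From `L` on the uniform error is below the gap `1/(j+1)` that holds off `E j`; shifting by `L`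
  -- gives the bound for all `l`.
  obtain ⟨L, hL⟩ := eventually_atTop.mp (Metric.tendstoUniformlyOn_iff.mp hunif _ hpos)
  refine ⟨t ∩ box n ∪ E j, ⟨(ht.inter hbox).union (hEmeas j),
    Set.union_subset Set.inter_subset_right fun q hq => hq.1, ?_⟩,
    fun l => d₀ + ns (l + L), fun l => u (ns (l + L)), ?_, fun l => hu _, ?_, ?_⟩
  · calc volume (t ∩ box n ∪ E j) ≤ volume (t ∩ box n) + volume (E j) := measure_union_le _ _
      _ ≤ ENNReal.ofReal (δ / 3) + ENNReal.ofReal (δ / 3) := by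
        refine add_le_add ?_ hj.le
        rwa [hμ, Measure.restrict_apply ht] at hμt
      _ = ENNReal.ofReal (δ / 3 + δ / 3) :=
        (ENNReal.ofReal_add (by positivity) (by positivity)).symm
      _ < ENNReal.ofReal δ := (ENNReal.ofReal_lt_ofReal_iff hδ).mpr (by linarith)
  · intro a b hab
    have := hns (show a + L < b + L by omega)
    change d₀ + ns (a + L) < d₀ + ns (b + L)
    omega
  · rw [Metric.tendstoUniformlyOn_iff] at hunif ⊢
    intro ε hε
    filter_upwards [(tendsto_add_atTop_nat L).eventually (hunif ε hε)] with l hl q hq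
    have := hl q fun hqt => hq.2 (Or.inl ⟨hqt, hq.1⟩)
    rwa [Set.indicator_of_mem hq.1] at this
  · intro l q hq
    have h1 := hL (l + L) (Nat.le_add_left _ _) q fun hqt => hq.2 (Or.inl ⟨hqt, hq.1⟩)
    rw [Set.indicator_of_mem hq.1, dist_comm, Real.dist_eq] at h1
    have h2 : 1 / ((j : ℝ) + 1) ≤ abscissa p q - abscissa p.derivative q := by
      by_contra! hlt
      exact hq.2 (Or.inr ⟨hq.1, hlt⟩)
    have h3 := (abs_lt.mp h1).2
    linarith

/-- If `D` has positive measure, then the polynomial that coincides with `a_{p'}` on `D` coincides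
with it everywhere. -/
theorem exists_upper_sequence_of_not_null (hp : HasConstantLead p)
    (hp' : HasConstantLead p.derivative) (h2 : ExactOnCoincidence p)
    (hD : volume (coincidenceSet p) ≠ 0) {δ : ℝ} (hδ : 0 < δ) :
    ∃ A : Set (Fin n → ℝ), IsSmallSet δ A ∧
      ∃ (k : ℕ → ℕ) (v : ℕ → PolyQ n), StrictMono k ∧
        (∀ l, UpperNearOptimal p.derivative (k l) (v l)) ∧
        TendstoUniformlyOn (fun l q => MvPolynomial.eval q (v l)) (abscissa p.derivative)
          atTop (box n \ A) ∧
        ∀ l, ∀ q ∈ box n \ A, MvPolynomial.eval q (v l) ≤ abscissa p q := by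
  obtain ⟨d, v, ⟨hv, -⟩, hvD⟩ := h2
  have heq : ∀ q ∈ box n, MvPolynomial.eval q v = abscissa p.derivative q := fun q hq =>
    le_antisymm (hp'.eval_le_abscissa v hD hvD q) (hv.abscissa_le hp' hq)
  refine ⟨∅, ⟨MeasurableSet.empty, Set.empty_subset _, by simpa using hδ⟩,
    fun l => d + l, fun _ => v, fun a b hab => by simpa using hab, fun l => ?_, ?_, ?_⟩
  · have hfeas : UpperFeasible p.derivative (d + l) v := hv.mono (Nat.le_add_right _ _)
    refine ⟨hfeas, ?_⟩
    -- `v` attains the lower bound `∫ a_{p'}` common to all orders, so it is exactly optimal at each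
    -- order from `d` on.
    have hint : ∫ q in box n, MvPolynomial.eval q v = ∫ q in box n, abscissa p.derivative q :=
      setIntegral_congr_fun (measurableSet_box n) heq
    have hle : ∫ q in box n, MvPolynomial.eval q v ≤ upperValue p.derivative (d + l) := by
      refine le_csInf ⟨_, v, hfeas, rfl⟩ ?_
      rintro _ ⟨w, hw, rfl⟩
      rw [hint]
      exact hw.integral_abscissa_le hp'
    have : (0 : ℝ) ≤ 1 / ((d + l : ℕ) : ℝ) := by positivity
    linarith
  · rw [Metric.tendstoUniformlyOn_iff]
    intro ε hε
    filter_upwards with l q hq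
    rw [heq q hq.1, dist_self]
    exact hε
  · intro l q hq
    change MvPolynomial.eval q v ≤ _
    rw [heq q hq.1]
    exact abscissa_derivative_le hp hp' q

end Sequence

/-! ### Convergence of the lower programs. -/

section Lower

variable {n : ℕ} {p : Polynomial (PolyQ n)} {v : PolyQ n} {d' : ℕ}

theorem LowerFeasible.mem_certModule {d : ℕ} {w : PolyQ n} (h : LowerFeasible p d' v d w) :
    varX - liftQ w ∈ certModule p (varX - liftQ v) := by
  obtain ⟨-, σ₀, σ, σv, τR, τI, h0, hσ, hv, -, -, e⟩ := h
  exact ⟨σ₀, σ, σv, τR, τI, h0.1, fun j => (hσ j).1, hv.1, e⟩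

theorem exists_lowerFeasible_of_mem_certModule (d' : ℕ) {w : PolyQ n}
    (h : varX - liftQ w ∈ certModule p (varX - liftQ v)) :
    ∃ d₀, ∀ d ≥ d₀, LowerFeasible p d' v d w := by
  obtain ⟨σ₀, σ, σh, τR, τI, h0, hσ, hh, e⟩ := h
  refine ⟨w.totalDegree + σ₀.totalDegree + ∑ j, (σ j).totalDegree + σh.totalDegree +
    τR.totalDegree + τI.totalDegree + p.natDegree + d' + 1, fun d hd => ?_⟩
  have hj : ∀ j, (σ j).totalDegree ≤ ∑ j, (σ j).totalDegree := fun j =>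
    Finset.single_le_sum (f := fun j => (σ j).totalDegree) (fun _ _ => Nat.zero_le _)
      (Finset.mem_univ j)
  refine ⟨Or.inr (by omega), σ₀, σ, σh, τR, τI, ⟨h0, Or.inr (by omega)⟩,
    fun j => ⟨hσ j, Or.inr ?_⟩, ⟨hh, Or.inr (by omega)⟩, Or.inr (by omega), Or.inr (by omega), e⟩
  have := hj j
  omega

/-- If any root satisfies the restriction, then the rightmost root does. -/
theorem mem_projRestricted_iff (hp : HasConstantLead p) {q : Fin n → ℝ} :
    q ∈ projRestricted p v ↔ q ∈ box n ∧ MvPolynomial.eval q v ≤ abscissa p q := by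
  constructor
  · rintro ⟨x, y, hz, hx⟩
    rw [mem_rootSet_iff] at hz
    have := hp.re_le_abscissa hz.2
    simp only at this hx
    exact ⟨hz.1, by linarith⟩
  · rintro ⟨hq, h⟩
    obtain ⟨s, hs, hre⟩ := hp.exists_root q
    refine ⟨s.re, s.im, mem_rootSet_iff.mpr ⟨hq, hs⟩, ?_⟩
    simp only [hre]
    linarith

theorem projRestricted_subset_box : projRestricted p v ⊆ box n := by
  rintro q ⟨x, y, hz, -⟩
  exact hz.1

theorem measurableSet_projRestricted (hp : HasConstantLead p) :
    MeasurableSet (projRestricted p v) := by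
  have : projRestricted p v = box n ∩
      {q | MvPolynomial.eval q v ≤ (box n).indicator (abscissa p) q} := by
    ext q
    rw [mem_projRestricted_iff hp]
    refine and_congr_right fun hq => ?_
    simp only [Set.mem_ofPred_eq, Set.indicator_of_mem hq]
  rw [this]
  exact (measurableSet_box n).inter (measurableSet_le
    (MvPolynomial.continuous_eval v).measurable hp.measurable_indicator_abscissa)

/-- On the restricted root set, `x` is the abscissa of `p`. -/
theorem eq_abscissa_of_mem_restrictedRootSet (hp : HasConstantLead p) (h1 : NoRootBetween p)
    (hv : ∀ q ∈ box n, abscissa p.derivative q ≤ MvPolynomial.eval q v)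
    (hb : NoBorderlineRoot p v) {q : Fin n → ℝ} {x y : ℝ}
    (hz : (q, x, y) ∈ restrictedRootSet p v) : x = abscissa p q := by
  obtain ⟨hz, hx⟩ := hz
  have hz' := mem_rootSet_iff.mp hz
  have hle := hp.re_le_abscissa hz'.2
  have hvq := hv q hz'.1
  have hn := h1 _ hz
  have hbz := hb _ hz
  simp only [Set.mem_Ioo, not_and, not_lt] at hle hx hn hbz
  refine le_antisymm hle ?_
  -- If `x < a_p`, then `a_{p'} ≤ v ≤ x` and assumption (1) force `x = v = a_{p'}`, the borderline
  -- case.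
  by_contra! hlt
  have hx' : x = abscissa p.derivative q := by
    refine le_antisymm ?_ (by linarith)
    by_contra! hlt'
    exact absurd hlt (not_lt.mpr (hn hlt'))
  exact hbz hx' hlt (by linarith)

theorem LowerFeasible.le_abscissa (hp : HasConstantLead p) {d : ℕ} {w : PolyQ n}
    (h : LowerFeasible p d' v d w) {q : Fin n → ℝ} (hq : q ∈ projRestricted p v) :
    MvPolynomial.eval q w ≤ abscissa p q := by
  rw [mem_projRestricted_iff hp] at hq
  obtain ⟨s, hs, hre⟩ := hp.exists_root q
  have := evalQXY_nonneg_of_mem_certModule h.mem_certModule (mem_rootSet_iff.mpr ⟨hq.1, hs⟩)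
    (by rw [evalQXY_sub, evalQXY_liftQ, evalQXY_varX]; linarith [hq.2])
  rw [evalQXY_sub, evalQXY_liftQ, evalQXY_varX] at this
  linarith

/-- Positivity of `x - w` is needed only on the restricted root set, where `x = a_p`; any `w`
strictly below `a_p` on the box is therefore certified. -/
theorem exists_lowerFeasible_near (hp : HasConstantLead p) (h1 : NoRootBetween p)
    (hv : ∀ q ∈ box n, abscissa p.derivative q ≤ MvPolynomial.eval q v)
    (hb : NoBorderlineRoot p v) (d' : ℕ) {ε : ℝ} (hε : 0 < ε) :
    ∃ (w : PolyQ n) (d₀ : ℕ), (∀ d ≥ d₀, LowerFeasible p d' v d w) ∧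
      ∀ q ∈ box n, abscissa p q - ε ≤ MvPolynomial.eval q w := by
  obtain ⟨w, hw⟩ := exists_mvPolynomial_near_of_continuousOn (isCompact_box n)
    (hp.continuousOn_abscissa.sub (continuousOn_const (c := ε / 2))) (half_pos hε)
  have hmem : varX - liftQ w ∈ certModule p (varX - liftQ v) := by
    obtain ⟨hdeg, c, hc, hlead⟩ := id hp
    refine mem_certModule_of_pos p hc hlead hdeg _ _ fun q x y hz hx => ?_
    rw [evalQXY_sub, evalQXY_liftQ, evalQXY_varX] at hx ⊢
    have h2 := (abs_lt.mp (hw q hz.1)).2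
    rw [eq_abscissa_of_mem_restrictedRootSet hp h1 hv hb ⟨hz, hx⟩]
    simp only [Pi.sub_apply] at h2
    linarith
  obtain ⟨d₀, hd₀⟩ := exists_lowerFeasible_of_mem_certModule d' hmem
  refine ⟨w, d₀, hd₀, fun q hq => ?_⟩
  have h2 := (abs_lt.mp (hw q hq)).1
  simp only [Pi.sub_apply] at h2
  linarith

theorem LowerFeasible.integral_le (hp : HasConstantLead p) {d : ℕ} {w : PolyQ n}
    (h : LowerFeasible p d' v d w) :
    ∫ q in projRestricted p v, MvPolynomial.eval q w ≤ ∫ q in projRestricted p v, abscissa p q :=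
  setIntegral_mono_on ((integrableOn_eval w).mono_set projRestricted_subset_box)
    (hp.integrableOn_abscissa.mono_set projRestricted_subset_box)
    (measurableSet_projRestricted hp) fun _ hq => h.le_abscissa hp hq

theorem bddAbove_lowerValue (hp : HasConstantLead p) (d : ℕ) :
    BddAbove {r : ℝ | ∃ w : PolyQ n, LowerFeasible p d' v d w ∧
      r = ∫ q in projRestricted p v, MvPolynomial.eval q w} :=
  ⟨∫ q in projRestricted p v, abscissa p q, by rintro _ ⟨w, hw, rfl⟩; exact hw.integral_le hp⟩

theorem exists_lowerNearOptimal (hp : HasConstantLead p) (h1 : NoRootBetween p)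
    (hv : ∀ q ∈ box n, abscissa p.derivative q ≤ MvPolynomial.eval q v)
    (hb : NoBorderlineRoot p v) (d' : ℕ) :
    ∃ d₀ ≥ d', ∀ d ≥ d₀, ∃ w, LowerNearOptimal p d' v d w := by
  obtain ⟨w, d₀, hw, -⟩ := exists_lowerFeasible_near hp h1 hv hb d' one_pos
  refine ⟨d₀ + d' + 1, by omega, fun d hd => ?_⟩
  have hd0 : (0 : ℝ) < 1 / d := by
    have : 0 < d := by omega
    positivity
  obtain ⟨_, ⟨u, hu, rfl⟩, hlt⟩ := exists_lt_of_lt_csSup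
    (s := {r : ℝ | ∃ w : PolyQ n, LowerFeasible p d' v d w ∧
      r = ∫ q in projRestricted p v, MvPolynomial.eval q w})
    ⟨_, w, hw d (by omega), rfl⟩ (sub_lt_self _ hd0)
  exact ⟨u, hu, hlt.le⟩

/-- Near optimal solutions of the lower programs converge to the abscissa in mean. -/
theorem tendsto_eLpNorm_lower (hp : HasConstantLead p) (h1 : NoRootBetween p)
    (hv : ∀ q ∈ box n, abscissa p.derivative q ≤ MvPolynomial.eval q v)
    (hb : NoBorderlineRoot p v) (d₀ : ℕ) (w : ℕ → PolyQ n)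
    (hw : ∀ d ≥ d₀, LowerNearOptimal p d' v d (w d)) :
    Tendsto (fun d => eLpNorm (fun q => MvPolynomial.eval q (w d) - abscissa p q) 1
      (volume.restrict (projRestricted p v))) atTop (𝓝 0) := by
  set S := projRestricted p v
  have hS : MeasurableSet S := measurableSet_projRestricted hp
  have hSb : S ⊆ box n := projRestricted_subset_box
  have hSfin : volume S ≠ ⊤ := ((measure_mono hSb).trans_lt (isCompact_box n).measure_lt_top).ne
  have hintw : ∀ u : PolyQ n, IntegrableOn (fun q => MvPolynomial.eval q u) S := fun u =>
    (integrableOn_eval u).mono_set hSb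
  have hinta : IntegrableOn (abscissa p) S := hp.integrableOn_abscissa.mono_set hSb
  have hnn : ∀ d ≥ d₀, 0 ≤ᵐ[volume.restrict S]
      fun q => abscissa p q - MvPolynomial.eval q (w d) := by
    intro d hd
    filter_upwards [ae_restrict_mem hS] with q hq
    exact sub_nonneg.mpr ((hw d hd).1.le_abscissa hp hq)
  have heq : ∀ d ≥ d₀, eLpNorm (fun q => MvPolynomial.eval q (w d) - abscissa p q) 1
      (volume.restrict S) =
        ENNReal.ofReal ((∫ q in S, abscissa p q) - ∫ q in S, MvPolynomial.eval q (w d)) := by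
    intro d hd
    have e := eLpNorm_one_eq_ofReal_integral
      (g := fun q => abscissa p q - MvPolynomial.eval q (w d))
      (hinta.sub (hintw (w d))) (hnn d hd)
    rw [← integral_sub hinta (hintw (w d)), ← e, ← eLpNorm_neg]
    congr 1
    ext q
    simp
  rw [tendsto_congr' (eventually_atTop.mpr ⟨d₀, heq⟩), ← ENNReal.ofReal_zero]
  refine ENNReal.tendsto_ofReal ?_
  rw [Metric.tendsto_atTop]
  intro ε hε
  set V := volume.real S
  have hV : 0 ≤ V := measureReal_nonneg
  obtain ⟨u, d₁, hu, hle⟩ := exists_lowerFeasible_near hp h1 hv hb d' (ε := ε / (2 * (V + 1)))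
    (by positivity)
  obtain ⟨d₂, hd₂⟩ := exists_nat_gt (2 / ε)
  refine ⟨d₀ + d₁ + d₂ + 1, fun d hd => ?_⟩
  have hd0 : d₀ ≤ d := by omega
  have e1 : (∫ q in S, abscissa p q) - ε / (2 * (V + 1)) * V ≤
      ∫ q in S, MvPolynomial.eval q u := by
    have := setIntegral_mono_on
      (hinta.sub (integrableOn_const (C := ε / (2 * (V + 1))) hSfin)) (hintw u) hS
      fun q hq => hle q (hSb hq)
    simp only [Pi.sub_apply] at this
    rw [integral_sub hinta (integrableOn_const hSfin), setIntegral_const, smul_eq_mul,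
      mul_comm] at this
    exact this
  have e2 : ∫ q in S, MvPolynomial.eval q u ≤ lowerValue p d' v d :=
    le_csSup (bddAbove_lowerValue hp d) ⟨u, hu _ (by omega), rfl⟩
  have e3 := (hw d hd0).2
  have e4 : 1 / (d : ℝ) < ε / 2 := by
    have : (d₂ : ℝ) ≤ d := by exact_mod_cast (show d₂ ≤ d by omega)
    have hpos : (0 : ℝ) < 2 / ε := by positivity
    rw [div_lt_iff₀ (by linarith)]
    have := (div_lt_iff₀ hε).mp (hd₂.trans_le this)
    linarith
  have e5 : ε / (2 * (V + 1)) * V ≤ ε / 2 := by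
    rw [div_mul_eq_mul_div, div_le_div_iff₀ (by positivity) (by positivity)]
    nlinarith
  have e6 := (hw d hd0).1.integral_le hp
  change ∫ q in S, MvPolynomial.eval q (w d) ≤ ∫ q in S, abscissa p q at e6
  change _ ≤ ∫ q in S, MvPolynomial.eval q (w d) at e3
  rw [Real.dist_eq, sub_zero, abs_of_nonneg (by linarith)]
  linarith

end Lower

end AbscissaGL

/-! ### The main theorem. -/

theorem mainTheorem4 {n : ℕ} (p : Polynomial (PolyQ n)) (hp : p.Monic) (hm : 2 ≤ p.natDegree)
    (h1 : NoRootBetween p) (h2 : ExactOnCoincidence p) (δ : ℝ) (hδ : 0 < δ) :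
    (∃ A : Set (Fin n → ℝ), IsSmallSet δ A ∧
      ∃ (k : ℕ → ℕ) (v : ℕ → PolyQ n), StrictMono k ∧
        (∀ l, UpperNearOptimal p.derivative (k l) (v l)) ∧
        TendstoUniformlyOn (fun l q => MvPolynomial.eval q (v l)) (abscissa p.derivative)
          atTop (box n \ A) ∧
        ∀ l, ∀ q ∈ box n \ A, MvPolynomial.eval q (v l) ≤ abscissa p q) ∧
    ∀ (A : Set (Fin n → ℝ)) (d' : ℕ) (v : PolyQ n), IsSmallSet δ A →
      UpperNearOptimal p.derivative d' v →
      (∀ q ∈ box n \ A, MvPolynomial.eval q v ≤ abscissa p q) →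
      NoBorderlineRoot p v →
      (∃ d₀ ≥ d', ∀ d ≥ d₀, ∃ w : PolyQ n, LowerNearOptimal p d' v d w) ∧
      MemLp (abscissa p) 1 (volume.restrict (box n)) ∧
      ∀ (d₀ : ℕ) (w : ℕ → PolyQ n), (∀ d ≥ d₀, LowerNearOptimal p d' v d (w d)) →
        (∀ d ≥ d₀, ∀ q ∈ box n \ A, MvPolynomial.eval q (w d) ≤ abscissa p q) ∧
        Tendsto (fun d => eLpNorm (fun q => MvPolynomial.eval q (w d) - abscissa p q) 1
          (volume.restrict (box n \ A))) atTop (𝓝 0) := by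
  have hpl : HasConstantLead p := hasConstantLead_of_monic hp (by omega)
  have hpl' : HasConstantLead p.derivative := hasConstantLead_derivative hp hm
  refine ⟨?_, ?_⟩
  · by_cases hD : volume (coincidenceSet p) = 0
    · exact exists_upper_sequence_of_null hpl hpl' hD hδ
    · exact exists_upper_sequence_of_not_null hpl hpl' h2 hD hδ
  · intro A d' v _ hv hvA hb
    have hv' : ∀ q ∈ box n, abscissa p.derivative q ≤ MvPolynomial.eval q v := fun q hq =>
      hv.1.abscissa_le hpl' hq
    -- This inclusion transfers both the pointwise bound and the convergence in mean from the
    -- projection to the complement of `A`.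
    have hsub : box n \ A ⊆ projRestricted p v := fun q hq =>
      (mem_projRestricted_iff hpl).mpr ⟨hq.1, hvA q hq⟩
    refine ⟨exists_lowerNearOptimal hpl h1 hv' hb d',
      memLp_one_iff_integrable.mpr hpl.integrableOn_abscissa, fun d₀ w hw => ⟨?_, ?_⟩⟩
    · intro d hd q hq
      exact (hw d hd).1.le_abscissa hpl (hsub hq)
    · exact tendsto_of_tendsto_of_tendsto_of_le_of_le tendsto_const_nhds
        (tendsto_eLpNorm_lower hpl h1 hv' hb d₀ w hw) (fun _ => zero_le)
        fun d => eLpNorm_mono_measure _ (Measure.restrict_mono hsub le_rfl)
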